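/- Let $n\ge 1$ and let $\sigma\in\{+,-\}^{n-1}$. Label $n+3$ points $0,1,\dots,n+2$ with the successive signs of the sequence $\widetilde\sigma=(+,-,\sigma,-,+)$, and place them in convex position in the plane, from left to right, so that the points with sign $+$ lie above a fixed horizontal line and those with sign $-$ lie below it; they are the vertices of a convex $(n+3)$-gon $P_{n+3}(\sigma)$. For a diagonal $ij$ ($i<j$) of $P_{n+3}(\sigma)$, let $R_{ij}(\sigma)$ be the set of vertices strictly below (the line through) it, and let $S_{ij}(\sigma)\subseteq\{1,\dots,n+1\}$ be obtained from $R_{ij}(\sigma)$ by replacing $0$ by $i$ if $0\in R_{ij}(\sigma)$, and $n+2$ by $j$ if $n+2\in R_{ij}(\sigma)$. The Hohlweg--Lange associahedron of $\sigma$ is the $n$-dimensional polytope $$\mathrm{Ass}^{\mathrm I}(\sigma)=\Big\{x\in\mathbb R^{n+1}:\ \sum_{k\in S_\delta(\sigma)}x_k\ge \tfrac12|S_\delta(\sigma)|(|S_\delta(\sigma)|+1)\ \text{ for all diagonals }\delta,\quad x_1+\cdots+x_{n+1}=\tfrac{(n+1)(n+2)}2\Big\}.$$ The normal fan of a polytope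 $P$ consists of the (outer) normal cones of the nonempty faces of $P$, where linear functionals are taken modulo those that are constant on $P$. Two polytopes are normally isomorphic if there is a linear isomorphism between the ambient spaces of their normal fans that sends the cones of one fan to the cones of the other. The reflection of $\sigma$ is $-\sigma$, and the reversal of $\sigma$ is the sequence $\sigma^t$ obtained by reversing the order of its entries. **Theorem.** Let $n\ge1$ and $\sigma_1,\sigma_2\in\{+,-\}^{n-1}$. Then $\mathrm{Ass}^{\mathrm I}(\sigma_1)$ and $\mathrm{Ass}^{\mathrm I}(\sigma_2)$ are normally isomorphic if and only if $\sigma_2$ can be obtained from $\sigma_1$ by a (possibly empty) finite sequence of reflections and reversals. -/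

import Mathlib

open scoped BigOperators

/-! ### Normal fans and normal isomorphism -/

section NormalFan

variable {E E' : Type*} [NormedAddCommGroup E] [NormedSpace ℝ E]
  [NormedAddCommGroup E'] [NormedSpace ℝ E']

/-- The linear functionals that are constant on `P`. For a nonempty polytope `P`, this is the
lineality space of its normal cones; it is `0` when `P` is full-dimensional. -/
def constantFunctionals (P : Set E) : Submodule ℝ (StrongDual ℝ E) where
  carrier := {f | ∀ x ∈ P, ∀ y ∈ P, f x = f y}
  add_mem' := by
    intro f g hf hg x hx y hy
    simp [hf x hx y hy, hg x hx y hy]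
  zero_mem' := by
    intro x _ y _
    rfl
  smul_mem' := by
    intro c f hf x hx y hy
    simp [hf x hx y hy]

/-- The space in which the normal fan of `P` is taken: functionals modulo those that are constant
on `P`, that is, the dual of the direction space of the affine hull of `P`.
Its dimension is the dimension of `P`. -/
abbrev NormalFanSpace (P : Set E) : Type _ := StrongDual ℝ E ⧸ constantFunctionals P

/-- The (outer) normal cone of a face `F` of `P`: all functionals whose maximum over `P` is
attained at every point of `F`, taken modulo functionals that are constant on `P`. -/
def normalCone (P F : Set E) : Set (NormalFanSpace P) :=
  (constantFunctionals P).mkQ '' {f : StrongDual ℝ E | ∀ x ∈ F, ∀ y ∈ P, f y ≤ f x}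

/-- The normal fan of a polytope `P`: the normal cones of its nonempty faces. The nonempty faces
of a polytope (`P` itself included) are its nonempty exposed subsets. -/
def normalFan (P : Set E) : Set (Set (NormalFanSpace P)) :=
  {C | ∃ F : Set E, F.Nonempty ∧ IsExposed ℝ P F ∧ C = normalCone P F}

/-- Two fans are linearly isomorphic if some linear isomorphism of the ambient spaces sends the
cones of one to the cones of the other. -/
def FansLinearlyIsomorphic {V W : Type*} [AddCommGroup V] [Module ℝ V]
    [AddCommGroup W] [Module ℝ W] (𝓕 : Set (Set V)) (𝓖 : Set (Set W)) : Prop :=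
  ∃ L : V ≃ₗ[ℝ] W, (fun C : Set V => L '' C) '' 𝓕 = 𝓖

/-- Two polytopes are normally isomorphic if their normal fans are linearly isomorphic. -/
def NormallyIsomorphic (P : Set E) (P' : Set E') : Prop :=
  FansLinearlyIsomorphic (normalFan P) (normalFan P')

end NormalFan

/-! ### Sign sequences -/

/-- Sequences of `n - 1` signs; the signs `+` and `-` are the units `1` and `-1` of `ℤ`. -/
abbrev SignSeq (n : ℕ) : Type := Fin (n - 1) → ℤˣ

/-- The reflection of a sign sequence: all signs are changed. -/
def SignSeq.reflection {n : ℕ} (σ : SignSeq n) : SignSeq n := fun i => -σ i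

/-- The reversal of a sign sequence: the order of the entries is reversed. -/
def SignSeq.reversal {n : ℕ} (σ : SignSeq n) : SignSeq n := fun i => σ i.rev

/-- `τ` is obtained from `σ` by a (possibly empty) finite sequence of reflections and
reversals. -/
def SignSeq.Equivalent {n : ℕ} (σ τ : SignSeq n) : Prop :=
  Relation.ReflTransGen (fun α β : SignSeq n => β = α.reflection ∨ β = α.reversal) σ τ

/-- The extended sequence `+, -, σ, -, +` of `n + 3` signs, indexed by `0, 1, …, n + 2`. -/
def SignSeq.extended {n : ℕ} (σ : SignSeq n) (i : Fin (n + 3)) : ℤˣ :=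
  if h : 2 ≤ (i : ℕ) ∧ (i : ℕ) ≤ n then σ ⟨(i : ℕ) - 2, by omega⟩
  else if (i : ℕ) = 0 ∨ (i : ℕ) = n + 2 then 1 else -1

/-! ### The polygon of a sign sequence -/

/-- The second coordinate of vertex `i` of the polygon of `σ`; the first coordinate is `i`. The
vertex lies above or below the horizontal axis according to its sign, on the graph of the strictly
concave function `x ↦ (x + 1) (n + 3 - x)` or on that of its negative, so that all `n + 3` vertices
are in (strictly) convex position. -/
def vertexHeight {n : ℕ} (σ : SignSeq n) (i : Fin (n + 3)) : ℤ :=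
  (σ.extended i : ℤ) * (((i : ℕ) + 1) * (n + 3 - (i : ℕ)))

/-- For `i < j`: the determinant that is negative, zero or positive according to whether vertex `k`
lies strictly below, on, or strictly above the line through the vertices `i` and `j`. -/
def heightOver {n : ℕ} (σ : SignSeq n) (i j k : Fin (n + 3)) : ℤ :=
  (vertexHeight σ k - vertexHeight σ i) * ((j : ℕ) - (i : ℕ))
    - (vertexHeight σ j - vertexHeight σ i) * ((k : ℕ) - (i : ℕ))

/-- `ij` with `i < j` is a diagonal of the polygon (and not an edge): there are vertices of the
polygon strictly on both sides of it. -/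
def IsDiagonal {n : ℕ} (σ : SignSeq n) (i j : Fin (n + 3)) : Prop :=
  i < j ∧ (∃ k, heightOver σ i j k < 0) ∧ (∃ k, 0 < heightOver σ i j k)

/-- The set `R_{ij}(σ)` of the vertices strictly below the diagonal `ij`. -/
def verticesBelow {n : ℕ} (σ : SignSeq n) (i j : Fin (n + 3)) : Finset (Fin (n + 3)) :=
  {k | heightOver σ i j k < 0}

/-- The set `S_{ij}(σ)`: in `R_{ij}(σ)`, the element `0` (if present) is replaced by `i` and the
element `n + 2` (if present) is replaced by `j`. -/
def normalSet {n : ℕ} (σ : SignSeq n) (i j : Fin (n + 3)) : Finset (Fin (n + 3)) :=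
  (verticesBelow σ i j).image
    (fun k => if k = 0 then i else if k = Fin.last (n + 2) then j else k)

/-! ### The Hohlweg–Lange associahedron -/

/-- The Hohlweg–Lange associahedron of `σ`. The coordinates `x_1, …, x_{n+1}` are indexed by
`Fin (n + 1)`: the coordinate with index `k` is `x_{k+1}`, and `k.succ.castSucc` is the element
`k + 1` of `{0, …, n + 2}`. -/
def hohlwegLangeAssociahedron {n : ℕ} (σ : SignSeq n) : Set (Fin (n + 1) → ℝ) :=
  {x | (∀ i j : Fin (n + 3), IsDiagonal σ i j →
          (1 / 2 : ℝ) * (normalSet σ i j).card * ((normalSet σ i j).card + 1)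
            ≤ ∑ k : Fin (n + 1) with k.succ.castSucc ∈ normalSet σ i j, x k) ∧
        ∑ k : Fin (n + 1), x k = ((n : ℝ) + 1) * (n + 2) / 2}

/-!
The rays of the normal fan of the associahedron already determine the sign sequence up to reflection
and reversal.

The sets `S_δ` of the diagonals `δ` are the *facet sets* of the sign pattern
(`SignSeq.exists_isDiagonal_iff`), a description that does not involve the signs of the first and
last coordinate. Changing all signs replaces the facet sets by their complements, which the map
`x ↦ (n + 2) - x` turns into an isomorphism of associahedra; reversing the signs reverses the
coordinates. An affine isomorphism of polytopes induces a linear isomorphism of the normal fans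
(`normallyIsomorphic_image`), so equivalent sequences have normally isomorphic associahedra.

For the converse, the associahedron is a polytope that contains the permutahedron and is cut out by
some of the facet inequalities of the latter. For every such polytope the rays of the normal fan are
spanned by the normals of the given inequalities (`exists_mem_normalFan_ray`,
`exists_jumpVector_of_ray`): the vertices of the permutahedron on a facet show that it has
codimension one, and a face on which no inequality is tight throughout contains a relative
interior point. In the coordinates `f ↦ f(e_g) - f(e_{g+1})`, the normal for `S` is the vector of
jumps of the indicator function of `S`, with entries `0`, `1`, `-1` of alternating signs.

Two facet sets are complementary only if they are an initial segment and a final one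
(`IsFacetSet.eq_of_compl`), and all these segments are facet sets. So the pairs of opposite rays span
the coordinate axes, which are indexed by the gaps between consecutive elements, and a linear
isomorphism of the fans permutes the axes. The vector `e_g - e_h` is a facet normal exactly if
all elements between the gaps `g` and `h` have the same sign, `-` if `g < h` and `+` if `h < g`
(`exists_isFacetSet_jumpVector_iff`). This relation, a system of arrows between gaps, is
preserved or, if the isomorphism acts on the axes by negative scalars, reversed. The arrows that do
not factor are those between neighbouring gaps, so the permutation of the gaps is an automorphism
of a path, that is, the identity or the reversal (`signs_eq_of_arrow_iff`), and the directions of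
the arrows between neighbouring gaps give the signs.
-/

/-! ### Linear isomorphisms of normal fans -/

section NormalIsomorphism

variable {E E' E'' : Type*} [NormedAddCommGroup E] [NormedSpace ℝ E]
  [NormedAddCommGroup E'] [NormedSpace ℝ E'] [NormedAddCommGroup E''] [NormedSpace ℝ E'']

theorem NormallyIsomorphic.refl (P : Set E) : NormallyIsomorphic P P :=
  ⟨LinearEquiv.refl ℝ _, (Set.image_congr fun C _ => Set.image_id C).trans (Set.image_id _)⟩

theorem NormallyIsomorphic.trans {P : Set E} {P' : Set E'} {P'' : Set E''}
    (h : NormallyIsomorphic P P') (h' : NormallyIsomorphic P' P'') :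
    NormallyIsomorphic P P'' := by
  obtain ⟨L, hL⟩ := h
  obtain ⟨L', hL'⟩ := h'
  refine ⟨L.trans L', ?_⟩
  rw [← hL', ← hL, Set.image_image]
  refine Set.image_congr fun C _ => ?_
  rw [Set.image_image]
  rfl

/-- The dual of an affine isomorphism carries the normal fan of a set to that of its image. -/
theorem normallyIsomorphic_image (A : E ≃L[ℝ] E') (b : E') (P : Set E) :
    NormallyIsomorphic P ((fun x => A x + b) '' P) := by
  set T : E → E' := fun x => A x + b with hT
  have hTsurj : Function.Surjective T := fun y => ⟨A.symm (y - b), by simp [hT]⟩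
  let φ : StrongDual ℝ E ≃ₗ[ℝ] StrongDual ℝ E' :=
    (A.arrowCongr (ContinuousLinearEquiv.refl ℝ ℝ)).toLinearEquiv
  have hφ : ∀ f x, φ f (T x) = f x + φ f b := fun f x => by
    simp [φ, hT]
  have hφ' : ∀ l x, l (T x) = φ.symm l x + l b := fun l x => by
    conv_lhs => rw [← φ.apply_symm_apply l]
    rw [hφ, φ.apply_symm_apply]
  have hconst : (constantFunctionals P).map (φ : StrongDual ℝ E →ₗ[ℝ] StrongDual ℝ E')
      = constantFunctionals (T '' P) := by
    ext l
    rw [Submodule.mem_map_equiv]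
    change (∀ x ∈ P, ∀ y ∈ P, _ = _) ↔ (∀ x ∈ T '' P, ∀ y ∈ T '' P, _ = _)
    simp only [Set.forall_mem_image, hφ', add_left_inj]
  let L : NormalFanSpace P ≃ₗ[ℝ] NormalFanSpace (T '' P) :=
    Submodule.Quotient.equiv _ _ φ hconst
  have hcone : ∀ F : Set E, L '' normalCone P F = normalCone (T '' P) (T '' F) := by
    intro F
    have h1 : {f : StrongDual ℝ E' | ∀ x ∈ T '' F, ∀ y ∈ T '' P, f y ≤ f x}
        = φ '' {f : StrongDual ℝ E | ∀ x ∈ F, ∀ y ∈ P, f y ≤ f x} := by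
      ext l
      rw [LinearEquiv.image_eq_preimage_symm]
      simp only [Set.forall_mem_image, hφ', Set.mem_ofPred_eq, Set.mem_preimage,
        add_le_add_iff_right]
    rw [normalCone, normalCone, h1, Set.image_image, Set.image_image]
    rfl
  have hexp : ∀ F : Set E, F.Nonempty → (IsExposed ℝ P F ↔ IsExposed ℝ (T '' P) (T '' F)) := by
    intro F hF
    have hTinj : Function.Injective T := fun x y hxy => by simpa [hT] using hxy
    have key : ∀ l : StrongDual ℝ E', {x ∈ T '' P | ∀ y ∈ T '' P, l y ≤ l x}
        = T '' {x ∈ P | ∀ y ∈ P, φ.symm l y ≤ φ.symm l x} := by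
      intro l
      ext z
      obtain ⟨z, rfl⟩ := hTsurj z
      simp only [Set.forall_mem_image, Set.mem_ofPred_eq, hTinj.mem_set_image, hφ',
        add_le_add_iff_right]
    constructor
    · intro h _
      obtain ⟨l, hl⟩ := h hF
      refine ⟨φ l, ?_⟩
      rw [key, φ.symm_apply_apply, hl]
    · intro h _
      obtain ⟨l, hl⟩ := h (hF.image T)
      refine ⟨φ.symm l, hTinj.image_injective ?_⟩
      rw [hl, key]
  refine ⟨L, ?_⟩
  ext C
  constructor
  · rintro ⟨_, ⟨F, hF, hFP, rfl⟩, rfl⟩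
    exact ⟨T '' F, hF.image T, (hexp F hF).1 hFP, hcone F⟩
  · rintro ⟨F', hF', hFP', rfl⟩
    have hFT : T '' (T ⁻¹' F') = F' := Set.image_preimage_eq F' hTsurj
    have hF : (T ⁻¹' F').Nonempty := hF'.preimage hTsurj
    refine ⟨normalCone P (T ⁻¹' F'), ⟨T ⁻¹' F', hF, (hexp _ hF).2 (by rwa [hFT]), rfl⟩, ?_⟩
    change L '' _ = _
    rw [hcone, hFT]

end NormalIsomorphism

/-! ### Polytopes containing the permutahedron -/

section FamilyPolytope

variable {n : ℕ}

/-- The polytope obtained from the permutahedron in `ℝ^(n+1)` by keeping only the facet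
inequalities `∑ k ∈ S, x k ≥ |S| (|S| + 1) / 2` with `S` in the family `𝓢`. -/
def familyPolytope (𝓢 : Set (Finset (Fin (n + 1)))) : Set (Fin (n + 1) → ℝ) :=
  {x | (∀ S ∈ 𝓢, (1 / 2 : ℝ) * S.card * (S.card + 1) ≤ ∑ k ∈ S, x k) ∧
    ∑ k, x k = ((n : ℝ) + 1) * (n + 2) / 2}

/-- A finite set of natural numbers `i` minimises `∑ (i + 1)` when it is an initial segment. -/
theorem card_mul_succ_le_two_mul_sum (T : Finset ℕ) :
    T.card * (T.card + 1) ≤ 2 * ∑ i ∈ T, (i + 1) := by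
  induction T using Finset.induction_on_max with
  | empty => simp
  | insert a s ha ih =>
    have hna : a ∉ s := fun h => lt_irrefl _ (ha a h)
    have hcard : s.card ≤ a := by
      have hsub : s ⊆ Finset.range a := fun i hi => Finset.mem_range.2 (ha i hi)
      simpa using Finset.card_le_card hsub
    rw [Finset.card_insert_of_notMem hna, Finset.sum_insert hna]
    nlinarith

/-- The vertex of the permutahedron belonging to the permutation `π`. -/
def permVertex (π : Equiv.Perm (Fin (n + 1))) (k : Fin (n + 1)) : ℝ := ((π k : ℕ) : ℝ) + 1

theorem sum_permVertex (π : Equiv.Perm (Fin (n + 1))) :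
    ∑ k, permVertex π k = ((n : ℝ) + 1) * (n + 2) / 2 := by
  have h : ∑ k, permVertex π k = ∑ k : Fin (n + 1), (((k : ℕ) : ℝ) + 1) :=
    Equiv.sum_comp π fun k : Fin (n + 1) => ((k : ℕ) : ℝ) + 1
  rw [h, Fin.sum_univ_eq_sum_range (fun i : ℕ => (i : ℝ) + 1)]
  clear h
  induction n with
  | zero => norm_num
  | succ m ih => rw [Finset.sum_range_succ, ih 1]; push_cast; ring

theorem le_sum_permVertex (π : Equiv.Perm (Fin (n + 1))) (S : Finset (Fin (n + 1))) :
    (1 / 2 : ℝ) * S.card * (S.card + 1) ≤ ∑ k ∈ S, permVertex π k := by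
  have h := card_mul_succ_le_two_mul_sum (S.map (π.toEmbedding.trans Fin.valEmbedding))
  rw [Finset.card_map, Finset.sum_map] at h
  have h' : ((S.card : ℝ) * (S.card + 1)) ≤ 2 * ∑ k ∈ S, permVertex π k := by
    simp only [permVertex]
    exact_mod_cast h
  linarith

theorem permVertex_mem (𝓢 : Set (Finset (Fin (n + 1)))) (π : Equiv.Perm (Fin (n + 1))) :
    permVertex π ∈ familyPolytope 𝓢 :=
  ⟨fun S _ => le_sum_permVertex π S, sum_permVertex π⟩

theorem permVertex_injective (π : Equiv.Perm (Fin (n + 1))) :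
    Function.Injective (permVertex π) := by
  intro k l h
  simp only [permVertex, add_left_inj, Nat.cast_inj] at h
  exact π.injective (Fin.ext h)

/-- Any set of coordinates can be filled with the smallest values by some vertex of the
permutahedron. -/
theorem exists_permVertex_sum_eq (S : Finset (Fin (n + 1))) :
    ∃ π : Equiv.Perm (Fin (n + 1)), (∀ k ∈ S, ∀ l ∉ S, permVertex π k < permVertex π l) ∧
      ∑ k ∈ S, permVertex π k = (1 / 2 : ℝ) * S.card * (S.card + 1) := by
  have hcard : S.card ≤ n + 1 := by simpa using S.card_le_univ
  have hT : Fintype.card {k // k ∈ S} = Fintype.card {k : Fin (n + 1) // (k : ℕ) < S.card} := by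
    rw [Fintype.card_coe, Fintype.card_subtype]
    rcases hcard.eq_or_lt with h | h
    · have : (Finset.univ.filter fun k : Fin (n + 1) => (k : ℕ) < S.card) = Finset.univ :=
        Finset.filter_true_of_mem fun k _ => by rw [h]; exact k.isLt
      rw [this]; simpa using h
    · have : (Finset.univ.filter fun k : Fin (n + 1) => (k : ℕ) < S.card)
          = Finset.Iio ⟨S.card, h⟩ := by
        ext k; simp [Fin.lt_def]
      rw [this, Fin.card_Iio]
  let e := Fintype.equivOfCardEq hT
  have hin : ∀ k ∈ S, ((e.extendSubtype k : Fin (n + 1)) : ℕ) < S.card := fun k hk =>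
    e.extendSubtype_mem k hk
  have hout : ∀ k ∉ S, ¬ ((e.extendSubtype k : Fin (n + 1)) : ℕ) < S.card := fun k hk =>
    e.extendSubtype_not_mem k hk
  refine ⟨e.extendSubtype, fun k hk l hl => ?_, ?_⟩
  · have := hin k hk
    have := hout l hl
    simp only [permVertex, add_lt_add_iff_right, Nat.cast_lt]
    omega
  · have himage : S.map (e.extendSubtype.toEmbedding.trans Fin.valEmbedding)
        = Finset.range S.card := by
      refine Finset.eq_of_subset_of_card_le (fun i hi => ?_) (by simp)
      obtain ⟨k, hk, rfl⟩ := Finset.mem_map.1 hi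
      exact Finset.mem_range.2 (hin k hk)
    have h1 : ∑ k ∈ S, permVertex e.extendSubtype k = ∑ i ∈ Finset.range S.card, ((i : ℝ) + 1) := by
      rw [← himage, Finset.sum_map]
      rfl
    rw [h1]
    generalize S.card = m
    induction m with
    | zero => simp
    | succ m ih => rw [Finset.sum_range_succ, ih]; push_cast; ring

/-- The value of a functional on the vertices of the permutahedron changes in proportion to the
difference of its two coefficients when two coordinates are swapped. -/
theorem apply_permVertex_swap_sub (f : StrongDual ℝ (Fin (n + 1) → ℝ))
    (π : Equiv.Perm (Fin (n + 1))) (k l : Fin (n + 1)) :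
    f (permVertex (Equiv.swap k l * π.symm).symm) - f (permVertex π)
      = (permVertex π l - permVertex π k) * (f (Pi.single k 1) - f (Pi.single l 1)) := by
  have h : permVertex (Equiv.swap k l * π.symm).symm
      = permVertex π + (permVertex π l - permVertex π k) •
        ((Pi.single k 1 : Fin (n + 1) → ℝ) - Pi.single l 1) := by
    ext m
    have hm : (Equiv.swap k l * π.symm).symm m = π (Equiv.swap k l m) := by
      rw [Equiv.symm_apply_eq]; simp
    have hv : permVertex (Equiv.swap k l * π.symm).symm m = permVertex π (Equiv.swap k l m) := by
      rw [permVertex, hm, permVertex]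
    rw [hv]
    by_cases hk : m = k
    · subst hk
      by_cases hl : m = l
      · subst hl; simp
      · simp [hl]
    · by_cases hl : m = l
      · subst hl; simp [hk]
      · simp [Equiv.swap_apply_of_ne_of_ne hk hl, hk, hl]
  rw [h]
  simp

theorem dual_apply_eq_sum (f : StrongDual ℝ (Fin (n + 1) → ℝ)) (x : Fin (n + 1) → ℝ) :
    f x = ∑ k, x k * f (Pi.single k 1) := by
  conv_lhs => rw [← Finset.univ_sum_single x, map_sum]
  refine Finset.sum_congr rfl fun k _ => ?_
  rw [← smul_eq_mul, ← map_smul, ← Pi.single_smul, smul_eq_mul, mul_one]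

/-- The differences of consecutive coefficients of a functional on `ℝ^(n+1)`. They are coordinates
for functionals modulo the multiples of the sum of the coordinates. -/
def coeffDiff (n : ℕ) : StrongDual ℝ (Fin (n + 1) → ℝ) →ₗ[ℝ] (Fin n → ℝ) where
  toFun f g := f (Pi.single g.castSucc 1) - f (Pi.single g.succ 1)
  map_add' f f' := by ext g; simp; ring
  map_smul' c f := by ext g; simp; ring

/-- The jumps of the indicator function of `S`: the `g`-th entry is positive if `S` contains
`g + 1` but not `g`, and negative in the opposite case. -/
def jumpVector (S : Finset (Fin (n + 1))) (g : Fin n) : ℝ :=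
  (if g.succ ∈ S then 1 else 0) - (if g.castSucc ∈ S then 1 else 0)

/-- The outer normal `-∑ k ∈ S, x k` of the facet belonging to `S`. -/
def outerNormal (S : Finset (Fin (n + 1))) : StrongDual ℝ (Fin (n + 1) → ℝ) :=
  -∑ k ∈ S, ContinuousLinearMap.proj k

theorem outerNormal_apply (S : Finset (Fin (n + 1))) (x : Fin (n + 1) → ℝ) :
    outerNormal S x = -∑ k ∈ S, x k := by
  simp [outerNormal]

theorem coeffDiff_outerNormal (S : Finset (Fin (n + 1))) :
    coeffDiff n (outerNormal S) = jumpVector S := by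
  ext g
  simp only [coeffDiff, LinearMap.coe_mk, AddHom.coe_mk, outerNormal_apply, jumpVector,
    Pi.single_apply, Finset.sum_ite_eq']
  ring

theorem coeff_eq_of_coeffDiff_eq_zero {f : StrongDual ℝ (Fin (n + 1) → ℝ)}
    (h : coeffDiff n f = 0) (k : Fin (n + 1)) : f (Pi.single k 1) = f (Pi.single 0 1) := by
  induction k using Fin.induction with
  | zero => rfl
  | succ g ih => rw [← ih]; exact (sub_eq_zero.1 (congrFun h g)).symm

theorem ker_coeffDiff (𝓢 : Set (Finset (Fin (n + 1)))) :
    constantFunctionals (familyPolytope 𝓢) = LinearMap.ker (coeffDiff n) := by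
  ext f
  rw [LinearMap.mem_ker]
  constructor
  · intro h
    ext g
    have h1 := apply_permVertex_swap_sub f 1 g.castSucc g.succ
    rw [h _ (permVertex_mem 𝓢 _) _ (permVertex_mem 𝓢 _), sub_self, eq_comm, mul_eq_zero] at h1
    rcases h1 with h1 | h1
    · exact absurd (permVertex_injective _ (sub_eq_zero.1 h1)) (Fin.castSucc_lt_succ).ne'
    · exact h1
  · intro h x hx y hy
    rw [dual_apply_eq_sum, dual_apply_eq_sum f y]
    simp only [coeff_eq_of_coeffDiff_eq_zero h]
    rw [← Finset.sum_mul, ← Finset.sum_mul, hx.2, hy.2]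

theorem jumpVector_Ioi (g : Fin n) : jumpVector (Finset.Ioi g.castSucc) = Pi.single g 1 := by
  ext h
  simp only [jumpVector, Finset.mem_Ioi, Fin.lt_def, Pi.single_apply, Fin.ext_iff, Fin.val_succ,
    Fin.val_castSucc]
  split_ifs <;> first | omega | norm_num

theorem range_coeffDiff (n : ℕ) : LinearMap.range (coeffDiff n) = ⊤ := by
  rw [eq_top_iff]
  rintro v -
  rw [pi_eq_sum_univ' v]
  refine Submodule.sum_mem _ fun g _ => Submodule.smul_mem _ _
    ⟨outerNormal (Finset.Ioi g.castSucc), ?_⟩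
  rw [coeffDiff_outerNormal, jumpVector_Ioi]

/-- Coordinates on the space of the normal fan, given by the differences of consecutive
coefficients. -/
noncomputable def fanCoord (𝓢 : Set (Finset (Fin (n + 1)))) :
    NormalFanSpace (familyPolytope 𝓢) ≃ₗ[ℝ] (Fin n → ℝ) :=
  (Submodule.quotEquivOfEq _ _ (ker_coeffDiff 𝓢)).trans
    ((coeffDiff n).quotKerEquivOfSurjective (LinearMap.range_eq_top.1 (range_coeffDiff n)))

theorem fanCoord_image_normalCone (𝓢 : Set (Finset (Fin (n + 1)))) (F : Set (Fin (n + 1) → ℝ)) :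
    fanCoord 𝓢 '' normalCone (familyPolytope 𝓢) F
      = coeffDiff n '' {f | ∀ x ∈ F, ∀ y ∈ familyPolytope 𝓢, f y ≤ f x} := by
  rw [normalCone, Set.image_image]
  rfl

/-- The ray spanned by a vector. -/
def ray {V : Type*} [AddCommGroup V] [Module ℝ V] (v : V) : Set V :=
  {w | ∃ t : ℝ, 0 ≤ t ∧ w = t • v}

theorem exists_mem_normalFan_ray {𝓢 : Set (Finset (Fin (n + 1)))} {S : Finset (Fin (n + 1))}
    (hS : S ∈ 𝓢) (hne : S.Nonempty) (huniv : S ≠ Finset.univ) :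
    ∃ C ∈ normalFan (familyPolytope 𝓢), fanCoord 𝓢 '' C = ray (jumpVector S) := by
  classical
  set P := familyPolytope 𝓢
  set F : Set (Fin (n + 1) → ℝ) := {x ∈ P | ∑ k ∈ S, x k = (1 / 2 : ℝ) * S.card * (S.card + 1)}
  obtain ⟨π, hπ, hπS⟩ := exists_permVertex_sum_eq S
  have hπF : permVertex π ∈ F := ⟨permVertex_mem 𝓢 π, hπS⟩
  obtain ⟨a, ha⟩ := hne
  obtain ⟨b, hb⟩ : ∃ b, b ∉ S := by
    by_contra! h
    exact huniv (Finset.eq_univ_iff_forall.2 h)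
  have hmax : ∀ x ∈ F, ∀ y ∈ P, outerNormal S y ≤ outerNormal S x := by
    intro x hx y hy
    rw [outerNormal_apply, outerNormal_apply, hx.2]
    exact neg_le_neg (hy.1 S hS)
  refine ⟨normalCone P F, ⟨F, ⟨_, hπF⟩, fun _ => ⟨outerNormal S, ?_⟩, rfl⟩, ?_⟩
  · ext x
    refine ⟨fun hx => ⟨hx.1, hmax x hx⟩, fun hx => ⟨hx.1, le_antisymm ?_ (hx.1.1 S hS)⟩⟩
    have := hx.2 _ hπF.1
    rw [outerNormal_apply, outerNormal_apply, hπS] at this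
    linarith
  rw [fanCoord_image_normalCone]
  ext v
  constructor
  · rintro ⟨f, hf, rfl⟩
    -- Swapping two coordinates on the same side of `S` moves `π` within the facet.
    have hswap : ∀ k l, (k ∈ S ↔ l ∈ S) → f (Pi.single k 1) = f (Pi.single l 1) := by
      intro k l hkl
      rcases eq_or_ne k l with rfl | hne
      · rfl
      have hF : permVertex (Equiv.swap k l * π.symm).symm ∈ F := by
        refine ⟨permVertex_mem 𝓢 _, ?_⟩
        have h1 := apply_permVertex_swap_sub (outerNormal S) π k l
        have h2 : outerNormal S (Pi.single k 1) = outerNormal S (Pi.single l 1) := by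
          simp [outerNormal_apply, Pi.single_apply, hkl]
        rw [h2, sub_self, mul_zero, outerNormal_apply, outerNormal_apply, hπS] at h1
        linarith
      have h1 := apply_permVertex_swap_sub f π k l
      rw [le_antisymm (hf _ hπF _ hF.1) (hf _ hF _ hπF.1), sub_self, eq_comm, mul_eq_zero,
        sub_eq_zero, sub_eq_zero] at h1
      exact h1.resolve_left fun h => hne (permVertex_injective π h).symm
    have hle : f (Pi.single a 1) ≤ f (Pi.single b 1) := by
      have h1 := apply_permVertex_swap_sub f π a b
      have h2 := hf _ hπF _ (permVertex_mem 𝓢 (Equiv.swap a b * π.symm).symm)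
      have h3 := hπ a ha b hb
      by_contra! h
      have := mul_pos (sub_pos.2 h3) (sub_pos.2 h)
      linarith
    have hcoef : ∀ k, f (Pi.single k 1)
        = if k ∈ S then f (Pi.single a 1) else f (Pi.single b 1) := by
      intro k
      split_ifs with hk
      · exact hswap k a (by simp [hk, ha])
      · exact hswap k b (by simp [hk, hb])
    refine ⟨f (Pi.single b 1) - f (Pi.single a 1), sub_nonneg.2 hle, ?_⟩
    ext g
    simp only [coeffDiff, LinearMap.coe_mk, AddHom.coe_mk, Pi.smul_apply, jumpVector, smul_eq_mul]
    rw [hcoef g.castSucc, hcoef g.succ]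
    split_ifs <;> ring
  · rintro ⟨t, ht, rfl⟩
    refine ⟨t • outerNormal S, fun x hx y hy => ?_, by rw [map_smul, coeffDiff_outerNormal]⟩
    exact mul_le_mul_of_nonneg_left (hmax x hx y hy) ht

theorem convex_familyPolytope (𝓢 : Set (Finset (Fin (n + 1)))) : Convex ℝ (familyPolytope 𝓢) := by
  intro x hx y hy a b ha hb hab
  have key : ∀ T : Finset (Fin (n + 1)),
      ∑ k ∈ T, (a • x + b • y) k = a * ∑ k ∈ T, x k + b * ∑ k ∈ T, y k := fun T => by
    simp [Finset.sum_add_distrib, Finset.mul_sum]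
  constructor
  · intro S hS
    have h1 := mul_le_mul_of_nonneg_left (hx.1 S hS) ha
    have h2 := mul_le_mul_of_nonneg_left (hy.1 S hS) hb
    rw [key]
    calc _ = (a + b) * (1 / 2 * (S.card : ℝ) * (S.card + 1)) := by rw [hab, one_mul]
      _ ≤ _ := by linarith
  · rw [key, hx.2, hy.2, ← add_mul, hab, one_mul]

/-- A functional that is maximal over the polytope at a point where all the facet inequalities are
strict is constant: one can move from that point in every direction of coordinate sum zero. -/
theorem coeffDiff_eq_zero_of_strict {𝓢 : Set (Finset (Fin (n + 1)))}
    {f : StrongDual ℝ (Fin (n + 1) → ℝ)} {x : Fin (n + 1) → ℝ} (hx : x ∈ familyPolytope 𝓢)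
    (hstrict : ∀ S ∈ 𝓢, (1 / 2 : ℝ) * S.card * (S.card + 1) < ∑ k ∈ S, x k)
    (hf : ∀ y ∈ familyPolytope 𝓢, f y ≤ f x) : coeffDiff n f = 0 := by
  ext g
  set d : Fin (n + 1) → ℝ := Pi.single g.castSucc 1 - Pi.single g.succ 1 with hd
  have hev : ∀ᶠ t : ℝ in nhds 0, ∀ S ∈ 𝓢,
      (1 / 2 : ℝ) * S.card * (S.card + 1) < ∑ k ∈ S, (x + t • d) k := by
    rw [(Set.toFinite 𝓢).eventually_all]
    intro S hS
    have hcont : Continuous fun t : ℝ => ∑ k ∈ S, (x + t • d) k := by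
      simp only [Pi.add_apply, Pi.smul_apply, smul_eq_mul]
      fun_prop
    refine hcont.tendsto 0 |>.eventually (lt_mem_nhds ?_)
    simpa using hstrict S hS
  obtain ⟨ε, hε, hball⟩ := Metric.eventually_nhds_iff.1 hev
  have hmem : ∀ t : ℝ, |t| < ε → t * f d ≤ 0 := by
    intro t ht
    have hy : x + t • d ∈ familyPolytope 𝓢 := by
      refine ⟨fun S hS => (hball (by simpa using ht) S hS).le, ?_⟩
      have hd0 : ∑ k, d k = 0 := by simp [hd]
      simp only [Pi.add_apply, Pi.smul_apply, smul_eq_mul, Finset.sum_add_distrib,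
        ← Finset.mul_sum, hd0, mul_zero, add_zero]
      exact hx.2
    have := hf _ hy
    rw [map_add, map_smul, smul_eq_mul] at this
    linarith
  have h1 := hmem (ε / 2) (by rw [abs_of_pos] <;> linarith)
  have h2 := hmem (-(ε / 2)) (by rw [abs_neg, abs_of_pos] <;> linarith)
  have h3 : f d = 0 := by nlinarith
  rw [hd, map_sub] at h3
  exact h3

/-- If no inequality is tight on all of `F`, then averaging gives a point of `F` at which all
inequalities are strict; so a proper face lies in one of the facets. -/
theorem exists_tight_of_isExposed {𝓢 : Set (Finset (Fin (n + 1)))} {F : Set (Fin (n + 1) → ℝ)}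
    (hF : F.Nonempty) (hFP : IsExposed ℝ (familyPolytope 𝓢) F)
    {f : StrongDual ℝ (Fin (n + 1) → ℝ)} (hf : ∀ x ∈ F, ∀ y ∈ familyPolytope 𝓢, f y ≤ f x)
    (hf0 : coeffDiff n f ≠ 0) :
    ∃ S ∈ 𝓢, ∀ x ∈ F, ∑ k ∈ S, x k = (1 / 2 : ℝ) * S.card * (S.card + 1) := by
  classical
  by_contra! hcon
  have hsub := hFP.subset
  have hconv := hFP.convex (convex_familyPolytope 𝓢)
  have havg : ∀ T : Finset (Finset (Fin (n + 1))), ∃ x ∈ F, ∀ S ∈ T, S ∈ 𝓢 →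
      (1 / 2 : ℝ) * S.card * (S.card + 1) < ∑ k ∈ S, x k := by
    intro T
    induction T using Finset.induction_on with
    | empty => obtain ⟨x, hx⟩ := hF; exact ⟨x, hx, by simp⟩
    | insert S T _ ih =>
      obtain ⟨x, hx, hxT⟩ := ih
      by_cases hS : S ∈ 𝓢
      · obtain ⟨y, hy, hyS⟩ := hcon S hS
        have hyS' := lt_of_le_of_ne ((hsub hy).1 S hS) hyS.symm
        refine ⟨(1 / 2 : ℝ) • x + (1 / 2 : ℝ) • y,
          hconv hx hy (by norm_num) (by norm_num) (by norm_num), fun R hR hR𝓢 => ?_⟩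
        have hRx := (hsub hx).1 R hR𝓢
        have hRy := (hsub hy).1 R hR𝓢
        have hsum : ∑ k ∈ R, ((1 / 2 : ℝ) • x + (1 / 2 : ℝ) • y) k
            = 1 / 2 * ∑ k ∈ R, x k + 1 / 2 * ∑ k ∈ R, y k := by
          simp [Finset.sum_add_distrib, Finset.mul_sum]
        rw [hsum]
        rcases Finset.mem_insert.1 hR with rfl | hRT
        · linarith
        · have := hxT R hRT hR𝓢
          linarith
      · refine ⟨x, hx, fun R hR hR𝓢 => ?_⟩
        rcases Finset.mem_insert.1 hR with rfl | hRT
        · exact absurd hR𝓢 hS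
        · exact hxT R hRT hR𝓢
  obtain ⟨x, hx, hxT⟩ := havg Finset.univ
  exact hf0 (coeffDiff_eq_zero_of_strict (hsub hx) (fun S hS => hxT S (Finset.mem_univ S) hS)
    (hf x hx))

theorem exists_jumpVector_of_ray {𝓢 : Set (Finset (Fin (n + 1)))}
    (h𝓢 : ∀ S ∈ 𝓢, jumpVector S ≠ 0)
    {C : Set (NormalFanSpace (familyPolytope 𝓢))} (hC : C ∈ normalFan (familyPolytope 𝓢))
    {v : Fin n → ℝ} (hv : v ≠ 0) (hCv : fanCoord 𝓢 '' C = ray v) :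
    ∃ S ∈ 𝓢, ∃ c : ℝ, 0 < c ∧ v = c • jumpVector S := by
  obtain ⟨F, hF, hFP, rfl⟩ := hC
  rw [fanCoord_image_normalCone] at hCv
  obtain ⟨f, hf, rfl⟩ : v ∈ coeffDiff n '' {f | ∀ x ∈ F, ∀ y ∈ familyPolytope 𝓢, f y ≤ f x} := by
    rw [hCv]; exact ⟨1, zero_le_one, (one_smul ℝ v).symm⟩
  obtain ⟨S, hS, htight⟩ := exists_tight_of_isExposed hF hFP hf hv
  have hmem : jumpVector S ∈ ray (coeffDiff n f) := by
    rw [← hCv]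
    refine ⟨outerNormal S, fun x hx y hy => ?_, coeffDiff_outerNormal S⟩
    rw [outerNormal_apply, outerNormal_apply, htight x hx]
    exact neg_le_neg (hy.1 S hS)
  obtain ⟨t, ht, hSt⟩ := hmem
  have ht0 : t ≠ 0 := by
    rintro rfl
    exact h𝓢 S hS (by rw [hSt, zero_smul])
  exact ⟨S, hS, t⁻¹, inv_pos.2 (lt_of_le_of_ne ht ht0.symm), by rw [hSt, inv_smul_smul₀ ht0]⟩

theorem jumpVector_ne_zero {S : Finset (Fin (n + 1))} (hne : S.Nonempty)
    (huniv : S ≠ Finset.univ) : jumpVector S ≠ 0 := by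
  intro h
  have hall : ∀ k, k ∈ S ↔ (0 : Fin (n + 1)) ∈ S := by
    intro k
    induction k using Fin.induction with
    | zero => rfl
    | succ g ih =>
      rw [← ih]
      have hg := congrFun h g
      simp only [jumpVector, Pi.zero_apply] at hg
      split_ifs at hg with h1 h2 h2 <;> simp_all
  obtain ⟨a, ha⟩ := hne
  exact huniv (Finset.eq_univ_iff_forall.2 fun k => (hall k).2 ((hall a).1 ha))

/-- A normal isomorphism maps the facet normals, up to positive factors, to facet normals. -/
theorem exists_linearEquiv_of_normallyIsomorphic {𝓢 𝓣 : Set (Finset (Fin (n + 1)))}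
    (h𝓢 : ∀ S ∈ 𝓢, S.Nonempty ∧ S ≠ Finset.univ) (h𝓣 : ∀ S ∈ 𝓣, S.Nonempty ∧ S ≠ Finset.univ)
    (h : NormallyIsomorphic (familyPolytope 𝓢) (familyPolytope 𝓣)) :
    ∃ M : (Fin n → ℝ) ≃ₗ[ℝ] (Fin n → ℝ),
      (∀ S ∈ 𝓢, ∃ T ∈ 𝓣, ∃ c : ℝ, 0 < c ∧ M (jumpVector S) = c • jumpVector T) ∧
      ∀ T ∈ 𝓣, ∃ S ∈ 𝓢, ∃ c : ℝ, 0 < c ∧ M.symm (jumpVector T) = c • jumpVector S := by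
  have key : ∀ {𝓢 𝓣 : Set (Finset (Fin (n + 1)))},
      (∀ S ∈ 𝓢, S.Nonempty ∧ S ≠ Finset.univ) → (∀ S ∈ 𝓣, S.Nonempty ∧ S ≠ Finset.univ) →
      ∀ L : NormalFanSpace (familyPolytope 𝓢) ≃ₗ[ℝ] NormalFanSpace (familyPolytope 𝓣),
      (∀ C ∈ normalFan (familyPolytope 𝓢), L '' C ∈ normalFan (familyPolytope 𝓣)) →
      ∀ S ∈ 𝓢, ∃ T ∈ 𝓣, ∃ c : ℝ, 0 < c ∧
        fanCoord 𝓣 (L ((fanCoord 𝓢).symm (jumpVector S))) = c • jumpVector T := by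
    intro 𝓢 𝓣 h𝓢 h𝓣 L hL S hS
    obtain ⟨C, hC, hCS⟩ := exists_mem_normalFan_ray hS (h𝓢 S hS).1 (h𝓢 S hS).2
    refine exists_jumpVector_of_ray (fun T hT => jumpVector_ne_zero (h𝓣 T hT).1 (h𝓣 T hT).2)
      (hL C hC) ?_ ?_
    · simpa using jumpVector_ne_zero (h𝓢 S hS).1 (h𝓢 S hS).2
    · have hC' : C = (fanCoord 𝓢).symm '' ray (jumpVector S) := by
        rw [← hCS, Set.image_image]; simp
      rw [hC', Set.image_image, Set.image_image]
      ext w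
      constructor
      · rintro ⟨_, ⟨t, ht, rfl⟩, rfl⟩
        exact ⟨t, ht, by simp⟩
      · rintro ⟨t, ht, rfl⟩
        exact ⟨t • jumpVector S, ⟨t, ht, rfl⟩, by simp⟩
  obtain ⟨L, hL⟩ := h
  refine ⟨((fanCoord 𝓢).symm.trans L).trans (fanCoord 𝓣), ?_, ?_⟩
  · exact key h𝓢 h𝓣 L fun C hC => hL ▸ ⟨C, hC, rfl⟩
  · refine key h𝓣 h𝓢 L.symm fun C hC => ?_
    rw [← hL] at hC
    obtain ⟨C, hC, rfl⟩ := hC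
    simpa [Set.image_image] using hC

end FamilyPolytope

/-! ### Facet sets of a sign pattern -/

section FacetSet

variable {n : ℕ}

/-- The sets `S_δ` of the diagonals `δ`, described by the set `u` of elements with sign `+`: between
two elements `p < q` the members of `S` are the elements with sign `-`, and `S` is constant up to
`p` and from `q` on, with a value prescribed by the sign of `p` unless `p` is the first element, and
by the sign of `q` unless `q` is the last element. In this form the signs of the first and
last element play no role. -/
def IsFacetSet (u : Fin (n + 1) → Prop) (S : Finset (Fin (n + 1))) : Prop :=
  S.Nonempty ∧ S ≠ Finset.univ ∧ ∃ p q, p < q ∧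
    (∀ k, k ≤ p → (k ∈ S ↔ p ∈ S)) ∧ (p ≠ 0 → (p ∈ S ↔ u p)) ∧
    (∀ k, p < k → k < q → (k ∈ S ↔ ¬ u k)) ∧
    (∀ k, q ≤ k → (k ∈ S ↔ q ∈ S)) ∧ (q ≠ Fin.last n → (q ∈ S ↔ u q))

theorem IsFacetSet.compl {u v : Fin (n + 1) → Prop} {S : Finset (Fin (n + 1))}
    (huv : ∀ k, k ≠ 0 → k ≠ Fin.last n → (v k ↔ ¬ u k)) (hS : IsFacetSet u S) :
    IsFacetSet v Sᶜ := by
  obtain ⟨hne, huniv, p, q, hpq, h1, h2, h3, h4, h5⟩ := hS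
  have hp : p ≠ Fin.last n := (hpq.trans_le (Fin.le_last q)).ne
  have hq : q ≠ 0 := ((Fin.zero_le p).trans_lt hpq).ne'
  refine ⟨?_, ?_, p, q, hpq, fun k hk => ?_, fun hp0 => ?_, fun k hk hk' => ?_, fun k hk => ?_,
    fun hq0 => ?_⟩
  · rwa [Finset.nonempty_iff_ne_empty, ne_eq, Finset.compl_eq_empty_iff]
  · rwa [ne_eq, Finset.compl_eq_univ_iff, ← ne_eq, ← Finset.nonempty_iff_ne_empty]
  · simp only [Finset.mem_compl, h1 k hk]
  · rw [Finset.mem_compl, h2 hp0, huv p hp0 hp]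
  · rw [Finset.mem_compl, h3 k hk hk', huv k ((Fin.zero_le p).trans_lt hk).ne'
      (hk'.trans_le (Fin.le_last q)).ne]
  · simp only [Finset.mem_compl, h4 k hk]
  · rw [Finset.mem_compl, h5 hq0, huv q hq hq0]

theorem IsFacetSet.map_rev {u v : Fin (n + 1) → Prop} {S : Finset (Fin (n + 1))}
    (huv : ∀ k, v k ↔ u k.rev) (hS : IsFacetSet u S) :
    IsFacetSet v (S.map Fin.revPerm.toEmbedding) := by
  have hmem : ∀ k, k ∈ S.map Fin.revPerm.toEmbedding ↔ k.rev ∈ S := fun k => by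
    simp [Finset.mem_map_equiv]
  obtain ⟨hne, huniv, p, q, hpq, h1, h2, h3, h4, h5⟩ := hS
  refine ⟨hne.map, ?_, q.rev, p.rev, Fin.rev_lt_rev.2 hpq, fun k hk => ?_, fun hq => ?_,
    fun k hk hk' => ?_, fun k hk => ?_, fun hp => ?_⟩
  · intro h
    refine huniv (Finset.eq_univ_iff_forall.2 fun k => ?_)
    have := (hmem k.rev).1 (h ▸ Finset.mem_univ _)
    rwa [Fin.rev_rev] at this
  · rw [hmem, hmem, Fin.rev_rev]
    exact h4 _ (Fin.le_rev_iff.1 hk)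
  · rw [hmem, huv, Fin.rev_rev]
    exact h5 fun h => hq (by rw [h, Fin.rev_last])
  · rw [hmem, huv]
    exact h3 _ (Fin.lt_rev_iff.1 hk') (Fin.rev_lt_iff.1 hk)
  · rw [hmem, hmem, Fin.rev_rev]
    exact h1 _ (Fin.rev_le_iff.1 hk)
  · rw [hmem, huv, Fin.rev_rev]
    exact h2 fun h => hp (by rw [h, Fin.rev_zero])

theorem exists_greatest {P : Fin (n + 1) → Prop} (h : ∃ k, P k) :
    ∃ p, P p ∧ ∀ k, P k → k ≤ p := by
  classical
  obtain ⟨k, hk⟩ := h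
  obtain ⟨p, hp, hmax⟩ := Finset.exists_max_image (Finset.univ.filter P) id ⟨k, by simpa using hk⟩
  exact ⟨p, by simpa using hp, fun k hk => hmax k (by simpa using hk)⟩

theorem exists_least {P : Fin (n + 1) → Prop} (h : ∃ k, P k) :
    ∃ p, P p ∧ ∀ k, P k → p ≤ k := by
  classical
  obtain ⟨k, hk⟩ := h
  obtain ⟨p, hp, hmin⟩ := Finset.exists_min_image (Finset.univ.filter P) id ⟨k, by simpa using hk⟩
  exact ⟨p, by simpa using hp, fun k hk => hmin k (by simpa using hk)⟩

theorem isFacetSet_Iic (u : Fin (n + 1) → Prop) (g : Fin n) :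
    IsFacetSet u (Finset.Iic g.castSucc) := by
  obtain ⟨p, ⟨hpg, hp⟩, hpmax⟩ := exists_greatest
    (P := fun k => k ≤ g.castSucc ∧ (k = 0 ∨ u k)) ⟨0, Fin.zero_le _, Or.inl rfl⟩
  obtain ⟨q, ⟨hqg, hq⟩, hqmin⟩ := exists_least
    (P := fun k => g.castSucc < k ∧ (k = Fin.last n ∨ ¬ u k))
    ⟨Fin.last n, Fin.castSucc_lt_last g, Or.inl rfl⟩
  refine ⟨⟨_, Finset.mem_Iic.2 hpg⟩, fun h => ?_, p, q, hpg.trans_lt hqg, fun k hk => ?_,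
    fun hp0 => ?_, fun k hk hk' => ?_, fun k hk => ?_, fun hq0 => ?_⟩
  · have := Finset.mem_Iic.1 (h ▸ Finset.mem_univ q)
    exact absurd hqg this.not_gt
  · simp only [Finset.mem_Iic, hpg, hk.trans hpg]
  · simp only [Finset.mem_Iic, hpg, hp.resolve_left hp0]
  · rw [Finset.mem_Iic]
    constructor
    · exact fun hkg hu => absurd (hpmax k ⟨hkg, Or.inr hu⟩) hk.not_ge
    · intro hu
      by_contra hkg
      exact absurd (hqmin k ⟨not_le.1 hkg, Or.inr hu⟩) hk'.not_ge
  · simp only [Finset.mem_Iic, hqg.not_ge, (hqg.trans_le hk).not_ge]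
  · simp only [Finset.mem_Iic, hqg.not_ge, hq.resolve_left hq0]

theorem isFacetSet_Ioi (u : Fin (n + 1) → Prop) (g : Fin n) :
    IsFacetSet u (Finset.Ioi g.castSucc) := by
  have h := (isFacetSet_Iic (fun k => ¬ u k) g).compl (v := u) fun k _ _ => not_not.symm
  have hcompl : (Finset.Iic g.castSucc)ᶜ = Finset.Ioi g.castSucc := by
    ext k; simp
  rwa [hcompl] at h

/-- Facets come in parallel pairs only for the initial segments and their complements: the two
middle intervals cannot overlap, so that both sets jump only once. -/
theorem IsFacetSet.eq_of_compl {u : Fin (n + 1) → Prop} {S : Finset (Fin (n + 1))}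
    (hS : IsFacetSet u S) (hS' : IsFacetSet u Sᶜ) :
    ∃ g : Fin n, S = Finset.Iic g.castSucc ∨ S = Finset.Ioi g.castSucc := by
  obtain ⟨hne, huniv, p, q, hpq, h1, -, h3, h4, -⟩ := hS
  obtain ⟨-, -, p', q', hpq', h1', -, h3', h4', -⟩ := hS'
  simp only [Finset.mem_compl, not_iff_not] at h1' h4'
  have hcut : ∀ r : Fin (n + 1), r ≠ 0 → (∀ k < r, k ∈ S ↔ 0 ∈ S) →
      (∀ k, r ≤ k → (k ∈ S ↔ r ∈ S)) →
      ∃ g : Fin n, S = Finset.Iic g.castSucc ∨ S = Finset.Ioi g.castSucc := by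
    intro r hr hlow hhigh
    obtain ⟨g, rfl⟩ := Fin.exists_succ_eq.2 hr
    refine ⟨g, ?_⟩
    simp only [← Fin.le_castSucc_iff] at hlow
    simp only [← Fin.castSucc_lt_iff_succ_le] at hhigh
    by_cases h0 : 0 ∈ S
    · left
      have hg : g.succ ∉ S := fun hg => huniv <| Finset.eq_univ_iff_forall.2 fun k => by
        rcases le_or_gt k g.castSucc with hk | hk
        · exact (hlow k hk).2 h0
        · exact (hhigh k hk).2 hg
      ext k
      rw [Finset.mem_Iic]
      rcases le_or_gt k g.castSucc with hk | hk
      · simp [hk, hlow k hk, h0]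
      · simp [hk.not_ge, hhigh k hk, hg]
    · right
      have hg : g.succ ∈ S := by
        obtain ⟨k, hkS⟩ := hne
        rcases le_or_gt k g.castSucc with hk | hk
        · exact absurd ((hlow k hk).1 hkS) h0
        · exact (hhigh k hk).1 hkS
      ext k
      rw [Finset.mem_Ioi]
      rcases le_or_gt k g.castSucc with hk | hk
      · simp [hk.not_gt, hlow k hk, h0]
      · simp [hk, hhigh k hk, hg]
  have hconst : ∀ k, k ≤ p → (k ∈ S ↔ 0 ∈ S) := fun k hk =>
    (h1 k hk).trans (h1 0 (Fin.zero_le p)).symm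
  have hconst' : ∀ k, k ≤ p' → (k ∈ S ↔ 0 ∈ S) := fun k hk =>
    (h1' k hk).trans (h1' 0 (Fin.zero_le p')).symm
  have hq0 : q ≠ 0 := ((Fin.zero_le p).trans_lt hpq).ne'
  have hq0' : q' ≠ 0 := ((Fin.zero_le p').trans_lt hpq').ne'
  by_cases hA : ∀ k < q, k ≤ p'
  · exact hcut q hq0 (fun k hk => hconst' k (hA k hk)) h4
  by_cases hB : ∀ k < q', k ≤ p
  · exact hcut q' hq0' (fun k hk => hconst k (hB k hk)) h4'
  by_cases hC : ∀ k < q, k ≤ p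
  · exact hcut q hq0 (fun k hk => hconst k (hC k hk)) h4
  by_cases hD : ∀ k < q', k ≤ p'
  · exact hcut q' hq0' (fun k hk => hconst' k (hD k hk)) h4'
  -- Otherwise the element after `p` and `p'` lies in both middle intervals.
  exfalso
  push Not at hA hB hC hD
  obtain ⟨a, ha, ha'⟩ := hA
  obtain ⟨b, hb, hb'⟩ := hB
  obtain ⟨c, hc, hc'⟩ := hC
  obtain ⟨d, hd, hd'⟩ := hD
  have hm : max p p' < q := max_lt hpq (ha'.trans ha)
  have hm' : max p p' < q' := max_lt (hb'.trans hb) hpq'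
  obtain ⟨m, hm1, hm2, hm3, hm4⟩ : ∃ m, p < m ∧ p' < m ∧ m < q ∧ m < q' := by
    refine ⟨⟨max (p : ℕ) p' + 1, ?_⟩, ?_, ?_, ?_, ?_⟩ <;> simp only [Fin.lt_def] at * <;> omega
  have e1 := h3 m hm1 hm3
  have e2 := h3' m hm2 hm4
  rw [Finset.mem_compl] at e2
  tauto

/-- The gap `g` lies between the elements `g` and `g + 1`. There is an arrow between two gaps if all
elements between them have the same sign; it points to the right if the sign is `-`, and to the left
if it is `+`. -/
def Arrow (u : Fin (n + 1) → Prop) (g h : Fin n) : Prop :=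
  (g < h ∧ ∀ k, g.castSucc < k → k ≤ h.castSucc → ¬ u k) ∨
    (h < g ∧ ∀ k, h.castSucc < k → k ≤ g.castSucc → u k)

theorem Arrow.ne {u : Fin (n + 1) → Prop} {g h : Fin n} (hgh : Arrow u g h) : g ≠ h := by
  rcases hgh with h | h
  · exact h.1.ne
  · exact h.1.ne'

theorem isFacetSet_Ioc_iff (u : Fin (n + 1) → Prop) {g h : Fin n} (hgh : g < h) :
    IsFacetSet u (Finset.Ioc g.castSucc h.castSucc) ↔
      ∀ k, g.castSucc < k → k ≤ h.castSucc → ¬ u k := by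
  have hgh' : g.castSucc < h.castSucc := hgh
  constructor
  · rintro ⟨-, -, p, q, hpq, h1, -, h3, h4, -⟩ k hk hk'
    have hp : p ∉ Finset.Ioc g.castSucc h.castSucc := fun hp => by
      simpa using (h1 0 (Fin.zero_le p)).2 hp
    have hq : q ∉ Finset.Ioc g.castSucc h.castSucc := fun hq => by
      have := (h4 _ (Fin.le_last q)).2 hq
      exact absurd (Finset.mem_Ioc.1 this).2 (Fin.castSucc_lt_last h).not_ge
    have hkS : k ∈ Finset.Ioc g.castSucc h.castSucc := Finset.mem_Ioc.2 ⟨hk, hk'⟩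
    refine (h3 k ?_ ?_).1 hkS
    · exact not_le.1 fun hkp => hp ((h1 k hkp).1 hkS)
    · exact not_le.1 fun hkq => hq ((h4 k hkq).1 hkS)
  · intro hu
    obtain ⟨p, ⟨hpg, hp⟩, hpmax⟩ := exists_greatest
      (P := fun k => k ≤ g.castSucc ∧ (k = 0 ∨ ¬ u k)) ⟨0, Fin.zero_le _, Or.inl rfl⟩
    obtain ⟨q, ⟨hqh, hq⟩, hqmin⟩ := exists_least
      (P := fun k => h.castSucc < k ∧ (k = Fin.last n ∨ ¬ u k))
      ⟨Fin.last n, Fin.castSucc_lt_last h, Or.inl rfl⟩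
    have hpS : ∀ k ≤ p, k ∉ Finset.Ioc g.castSucc h.castSucc := fun k hk hkS =>
      absurd (Finset.mem_Ioc.1 hkS).1 (hk.trans hpg).not_gt
    have hqS : ∀ k, q ≤ k → k ∉ Finset.Ioc g.castSucc h.castSucc := fun k hk hkS =>
      absurd (Finset.mem_Ioc.1 hkS).2 (hqh.trans_le hk).not_ge
    refine ⟨⟨_, Finset.mem_Ioc.2 ⟨hgh', le_rfl⟩⟩, fun hS => ?_, p, q,
      hpg.trans_lt (hgh'.trans hqh), fun k hk => ?_, fun hp0 => ?_, fun k hk hk' => ?_,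
      fun k hk => ?_, fun hq0 => ?_⟩
    · exact hpS p le_rfl (hS ▸ Finset.mem_univ p)
    · exact iff_of_false (hpS k hk) (hpS p le_rfl)
    · exact iff_of_false (hpS p le_rfl) (hp.resolve_left hp0)
    · rw [Finset.mem_Ioc]
      refine ⟨fun hkS => hu k hkS.1 hkS.2, fun hk0 => ⟨?_, ?_⟩⟩
      · exact not_le.1 fun hkg => absurd (hpmax k ⟨hkg, Or.inr hk0⟩) hk.not_ge
      · exact not_lt.1 fun hkh => absurd (hqmin k ⟨hkh, Or.inr hk0⟩) hk'.not_ge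
    · exact iff_of_false (hqS k hk) (hqS q le_rfl)
    · exact iff_of_false (hqS q le_rfl) (hq.resolve_left hq0)

/-! ### Jump vectors of facet sets -/

theorem jumpVector_compl (S : Finset (Fin (n + 1))) : jumpVector Sᶜ = -jumpVector S := by
  ext g
  by_cases h1 : g.succ ∈ S <;> by_cases h2 : g.castSucc ∈ S <;> simp [jumpVector, h1, h2]

theorem jumpVector_Iic (g : Fin n) : jumpVector (Finset.Iic g.castSucc) = -Pi.single g 1 := by
  have h : Finset.Iic g.castSucc = (Finset.Ioi g.castSucc)ᶜ := by ext k; simp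
  rw [h, jumpVector_compl, jumpVector_Ioi]

theorem jumpVector_Ioc {g h : Fin n} (hgh : g < h) :
    jumpVector (Finset.Ioc g.castSucc h.castSucc) = Pi.single g 1 - Pi.single h 1 := by
  ext i
  simp only [jumpVector, Finset.mem_Ioc, Fin.lt_def, Fin.le_def, Pi.single_apply, Fin.ext_iff,
    Fin.val_succ, Fin.val_castSucc, Pi.sub_apply] at *
  split_ifs <;> first | omega | norm_num

theorem jumpVector_injective {S T : Finset (Fin (n + 1))} (hS : S.Nonempty)
    (hS' : S ≠ Finset.univ) (h : jumpVector S = jumpVector T) : S = T := by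
  have hstep : ∀ g : Fin n, (if g.succ ∈ S then (1 : ℝ) else 0) - (if g.succ ∈ T then 1 else 0)
      = (if g.castSucc ∈ S then 1 else 0) - (if g.castSucc ∈ T then 1 else 0) := fun g => by
    have := congrFun h g
    simp only [jumpVector] at this
    linarith
  have hconst : ∀ k, (if k ∈ S then (1 : ℝ) else 0) - (if k ∈ T then 1 else 0)
      = (if 0 ∈ S then 1 else 0) - (if 0 ∈ T then 1 else 0) := by
    intro k
    induction k using Fin.induction with
    | zero => rfl
    | succ g ih => rw [hstep, ih]
  obtain ⟨a, ha⟩ := hS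
  obtain ⟨b, hb⟩ : ∃ b, b ∉ S := by
    by_contra! h
    exact hS' (Finset.eq_univ_iff_forall.2 h)
  ext k
  have hka := hconst a
  have hkb := hconst b
  have hkk := hconst k
  rw [← hka] at hkb hkk
  simp only [ha, hb, if_true, if_false] at hkb hkk
  split_ifs at hkb hkk <;> first | tauto | (exfalso; linarith)

theorem sum_jumpVector (S : Finset (Fin (n + 1))) :
    ∑ g, jumpVector S g = (if Fin.last n ∈ S then 1 else 0) - (if 0 ∈ S then 1 else 0) := by
  simp only [jumpVector, Finset.sum_sub_distrib]
  have h1 := Fin.sum_univ_succ fun k : Fin (n + 1) => if k ∈ S then (1 : ℝ) else 0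
  have h2 := Fin.sum_univ_castSucc fun k : Fin (n + 1) => if k ∈ S then (1 : ℝ) else 0
  linarith

theorem jumpVector_apply_cases (S : Finset (Fin (n + 1))) (g : Fin n) :
    jumpVector S g = 0 ∨ jumpVector S g = 1 ∨ jumpVector S g = -1 := by
  simp only [jumpVector]
  split_ifs <;> norm_num

/-- Vectors with entries `0`, `1`, `-1` on the same ray are equal. -/
theorem eq_of_smul_eq_smul {v w : Fin n → ℝ} (hv : ∀ g, v g = 0 ∨ v g = 1 ∨ v g = -1)
    (hw : ∀ g, w g = 0 ∨ w g = 1 ∨ w g = -1) {c d : ℝ} (hc : 0 < c) (hd : 0 < d)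
    (h : c • v = d • w) : v = w := by
  ext g
  have hg := congrFun h g
  simp only [Pi.smul_apply, smul_eq_mul] at hg
  rcases hv g with h1 | h1 | h1 <;> rcases hw g with h2 | h2 | h2 <;> rw [h1, h2] at hg ⊢ <;>
    first | rfl | (exfalso; linarith)

theorem exists_isFacetSet_jumpVector_iff (u : Fin (n + 1) → Prop) {g h : Fin n} (hgh : g ≠ h) :
    (∃ S, IsFacetSet u S ∧ jumpVector S = Pi.single g 1 - Pi.single h 1) ↔ Arrow u g h := by
  have hcompl : ∀ S, IsFacetSet u Sᶜ ↔ IsFacetSet (fun k => ¬ u k) S := fun S =>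
    ⟨fun hS => by simpa using hS.compl (v := fun k => ¬ u k) fun _ _ _ => Iff.rfl,
      fun hS => hS.compl fun _ _ _ => not_not.symm⟩
  rcases lt_or_gt_of_ne hgh with hlt | hlt
  · have hJ := jumpVector_Ioc hlt
    have hA : Arrow u g h ↔ IsFacetSet u (Finset.Ioc g.castSucc h.castSucc) := by
      simp [Arrow, hlt, hlt.not_gt, isFacetSet_Ioc_iff u hlt]
    rw [hA]
    refine ⟨fun ⟨S, hS, hSJ⟩ => ?_, fun hS => ⟨_, hS, hJ⟩⟩
    rwa [← jumpVector_injective hS.1 hS.2.1 (hSJ.trans hJ.symm)]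
  · have hJ : jumpVector (Finset.Ioc h.castSucc g.castSucc)ᶜ = Pi.single g 1 - Pi.single h 1 := by
      rw [jumpVector_compl, jumpVector_Ioc hlt, neg_sub]
    have hA : Arrow u g h ↔ IsFacetSet u (Finset.Ioc h.castSucc g.castSucc)ᶜ := by
      rw [hcompl, isFacetSet_Ioc_iff _ hlt]
      simp [Arrow, hlt, hlt.not_gt]
    rw [hA]
    refine ⟨fun ⟨S, hS, hSJ⟩ => ?_, fun hS => ⟨_, hS, hJ⟩⟩
    rwa [← jumpVector_injective hS.1 hS.2.1 (hSJ.trans hJ.symm)]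

end FacetSet

/-! ### Arrow-preserving permutations of the gaps -/

section Recovery

variable {n : ℕ}

/-- An injective sequence of integers with steps `±1` is monotone. -/
theorem eq_add_or_eq_sub_of_steps {f : ℕ → ℤ} {n : ℕ}
    (hstep : ∀ i, i + 1 < n → f (i + 1) = f i + 1 ∨ f (i + 1) = f i - 1)
    (hinj : ∀ i j, i < n → j < n → f i = f j → i = j) :
    (∀ i < n, f i = f 0 + i) ∨ (∀ i < n, f i = f 0 - i) := by
  rcases Nat.lt_or_ge 1 n with hn | hn
  · have key : ∀ ε : ℤ, (ε = 1 ∨ ε = -1) → f 1 = f 0 + ε →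
        ∀ i, i + 1 < n → f i = f 0 + ε * i ∧ f (i + 1) = f 0 + ε * (i + 1) := by
      intro ε hε h1 i
      induction i with
      | zero => intro _; simpa using h1
      | succ i ih =>
        intro hi
        obtain ⟨ha, hb⟩ := ih (by omega)
        refine ⟨by push_cast; exact hb, ?_⟩
        have hne : f (i + 1 + 1) ≠ f i := fun h => by
          have := hinj _ _ hi (by omega) h
          omega
        push_cast
        rcases hε with rfl | rfl <;> rcases hstep (i + 1) hi with h | h <;> omega
    have hall : ∀ ε : ℤ, (ε = 1 ∨ ε = -1) → f 1 = f 0 + ε → ∀ i < n, f i = f 0 + ε * i := by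
      intro ε hε h1 i hi
      rcases Nat.eq_zero_or_pos i with rfl | hpos
      · simp
      · obtain ⟨j, rfl⟩ := Nat.exists_eq_add_of_lt hpos
        have := (key ε hε h1 (0 + j) hi).2
        push_cast at this ⊢
        exact this
    rcases hstep 0 hn with h | h
    · left
      intro i hi
      rw [hall 1 (Or.inl rfl) h i hi, one_mul]
    · right
      intro i hi
      rw [hall (-1) (Or.inr rfl) h i hi]
      ring
  · left
    intro i hi
    obtain rfl : i = 0 := by omega
    simp

theorem eq_id_or_eq_rev {π : Fin n → Fin n} (hπ : Function.Injective π)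
    (hstep : ∀ g h : Fin n, (h : ℕ) = g + 1 →
      ((π h : ℕ) = π g + 1 ∨ (π g : ℕ) = π h + 1)) :
    (∀ g, π g = g) ∨ (∀ g, π g = g.rev) := by
  rcases Nat.eq_zero_or_pos n with rfl | hn
  · exact Or.inl fun g => g.elim0
  set f : ℕ → ℤ := fun i => if h : i < n then ((π ⟨i, h⟩ : ℕ) : ℤ) else 0 with hf
  have hfi : ∀ i (h : i < n), f i = ((π ⟨i, h⟩ : ℕ) : ℤ) := fun i h => by simp [hf, h]
  have h := eq_add_or_eq_sub_of_steps (f := f) (n := n) (fun i hi => ?_) (fun i j hi hj hij => ?_)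
  · have h0 := hfi 0 hn
    have hlast := hfi (n - 1) (by omega)
    have hb := (π ⟨n - 1, by omega⟩).isLt
    have hb0 := (π ⟨0, hn⟩).isLt
    rcases h with h | h
    · left
      intro g
      have h1 := h g g.isLt
      have h2 := h (n - 1) (by omega)
      rw [hfi g g.isLt] at h1
      apply Fin.ext
      simp only [Fin.eta] at h1
      omega
    · right
      intro g
      have h1 := h g g.isLt
      have h2 := h (n - 1) (by omega)
      rw [hfi g g.isLt] at h1
      apply Fin.ext
      rw [Fin.val_rev]
      simp only [Fin.eta] at h1
      omega
  · rw [hfi i (by omega), hfi (i + 1) hi]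
    have := hstep ⟨i, by omega⟩ ⟨i + 1, hi⟩ rfl
    omega
  · rw [hfi i hi, hfi j hj] at hij
    have := hπ (Fin.ext (by exact_mod_cast hij) : π ⟨i, hi⟩ = π ⟨j, hj⟩)
    simpa using this

theorem arrow_of_val_eq_succ {u : Fin (n + 1) → Prop} {g h : Fin n} (hgh : (h : ℕ) = g + 1) :
    (Arrow u g h ↔ ¬ u h.castSucc) ∧ (Arrow u h g ↔ u h.castSucc) := by
  have hlt : g < h := Fin.lt_def.2 (by omega)
  have hk : ∀ k : Fin (n + 1), g.castSucc < k → k ≤ h.castSucc → k = h.castSucc := by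
    intro k hk hk'
    simp only [Fin.lt_def, Fin.le_def, Fin.ext_iff, Fin.val_castSucc] at *
    omega
  have hgh' : g.castSucc < h.castSucc := hlt
  constructor
  · simp only [Arrow, hlt, hlt.not_gt, true_and, false_and, or_false]
    exact ⟨fun H => H _ hgh' le_rfl, fun H k h1 h2 => hk k h1 h2 ▸ H⟩
  · simp only [Arrow, hlt, hlt.not_gt, true_and, false_and, false_or]
    exact ⟨fun H => H _ hgh' le_rfl, fun H k h1 h2 => hk k h1 h2 ▸ H⟩

/-- The arrows that do not factor through a third gap are those between neighbouring gaps. -/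
theorem Arrow.not_factor {u : Fin (n + 1) → Prop} {g h x : Fin n}
    (hgh : (h : ℕ) = g + 1 ∨ (g : ℕ) = h + 1) (hu : Arrow u g h) (h1 : Arrow u g x)
    (h2 : Arrow u x h) : False := by
  have hxg := h1.ne
  have hxh := h2.ne
  rcases hgh with hgh | hgh
  · have huh := (arrow_of_val_eq_succ hgh).1.1 hu
    rcases h2 with ⟨hlt, h2⟩ | ⟨hlt, h2⟩
    · have hxg' : x < g := by
        simp only [Fin.lt_def, ne_eq, Fin.ext_iff] at *; omega
      rcases h1 with ⟨hlt', h1⟩ | ⟨hlt', h1⟩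
      · exact absurd hlt' hxg'.not_gt
      · exact h2 g.castSucc hxg' (by simp only [Fin.le_def, Fin.val_castSucc]; omega)
          (h1 g.castSucc hxg' le_rfl)
    · rcases h1 with ⟨hlt', h1⟩ | ⟨hlt', h1⟩
      · exact h1 x.castSucc hlt' le_rfl (h2 x.castSucc hlt le_rfl)
      · simp only [Fin.lt_def] at *; omega
  · have hug := (arrow_of_val_eq_succ hgh).2.1 hu
    rcases h1 with ⟨hlt, h1⟩ | ⟨hlt, h1⟩
    · rcases h2 with ⟨hlt', h2⟩ | ⟨hlt', h2⟩
      · simp only [Fin.lt_def] at *; omega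
      · exact h1 x.castSucc hlt le_rfl (h2 x.castSucc hlt' le_rfl)
    · rcases h2 with ⟨hlt', h2⟩ | ⟨hlt', h2⟩
      · exact h2 h.castSucc hlt' le_rfl
          (h1 h.castSucc hlt' (by simp only [Fin.le_def, Fin.val_castSucc]; omega))
      · simp only [Fin.lt_def, ne_eq, Fin.ext_iff] at *; omega

theorem Arrow.exists_factor {u : Fin (n + 1) → Prop} {g h : Fin n} (hu : Arrow u g h)
    (h1 : (h : ℕ) ≠ g + 1) (h2 : (g : ℕ) ≠ h + 1) : ∃ x, Arrow u g x ∧ Arrow u x h := by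
  rcases hu with ⟨hlt, hu⟩ | ⟨hlt, hu⟩
  · refine ⟨⟨g + 1, by omega⟩, Or.inl ⟨?_, fun k hk hk' => hu k hk ?_⟩,
      Or.inl ⟨?_, fun k hk hk' => hu k ?_ hk'⟩⟩ <;>
    · simp only [Fin.lt_def, Fin.le_def, Fin.val_castSucc] at *
      omega
  · refine ⟨⟨h + 1, by omega⟩, Or.inr ⟨?_, fun k hk hk' => hu k ?_ hk'⟩,
      Or.inr ⟨?_, fun k hk hk' => hu k hk ?_⟩⟩ <;>
    · simp only [Fin.lt_def, Fin.le_def, Fin.val_castSucc] at *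
      omega

/-- A permutation of the gaps that preserves arrows preserves neighbours, so it is the identity or
the reversal, and the signs can be read off from the arrows between neighbouring gaps. -/
theorem signs_eq_of_arrow_iff {u v : Fin (n + 1) → Prop} {π : Fin n → Fin n}
    (hπ : Function.Injective π) (h : ∀ g h, Arrow u g h ↔ Arrow v (π g) (π h)) :
    (∀ k, k ≠ 0 → k ≠ Fin.last n → (v k ↔ u k)) ∨
      (∀ k, k ≠ 0 → k ≠ Fin.last n → (v k ↔ ¬ u k.rev)) := by
  have hsurj : Function.Surjective π := Finite.surjective_of_injective hπ
  have hcover : ∀ x y : Fin n, ((y : ℕ) = x + 1 ∨ (x : ℕ) = y + 1) → Arrow u x y →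
      ((π y : ℕ) = π x + 1 ∨ (π x : ℕ) = π y + 1) := by
    intro x y hxy hu
    by_contra! hcon
    obtain ⟨z, hz1, hz2⟩ := Arrow.exists_factor ((h x y).1 hu) hcon.1 hcon.2
    obtain ⟨z, rfl⟩ := hsurj z
    exact hu.not_factor hxy ((h _ _).2 hz1) ((h _ _).2 hz2)
  have hstep : ∀ x y : Fin n, (y : ℕ) = x + 1 →
      ((π y : ℕ) = π x + 1 ∨ (π x : ℕ) = π y + 1) := by
    intro x y hxy
    by_cases hu : u y.castSucc
    · exact (hcover y x (Or.inr hxy) ((arrow_of_val_eq_succ hxy).2.2 hu)).symm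
    · exact hcover x y (Or.inl hxy) ((arrow_of_val_eq_succ hxy).1.2 hu)
  have hgaps : ∀ k : Fin (n + 1), k ≠ 0 → k ≠ Fin.last n →
      ∃ x y : Fin n, (y : ℕ) = x + 1 ∧ k = y.castSucc := by
    intro k h0 hl
    have h0' : (k : ℕ) ≠ 0 := fun h => h0 (Fin.ext h)
    have hl' : (k : ℕ) ≠ n := fun h => hl (Fin.ext h)
    exact ⟨⟨k - 1, by omega⟩, ⟨k, by omega⟩, by simp only; omega, rfl⟩
  rcases eq_id_or_eq_rev hπ hstep with hid | hrev
  · left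
    intro k h0 hl
    obtain ⟨x, y, hxy, rfl⟩ := hgaps k h0 hl
    have := h y x
    rw [hid, hid, (arrow_of_val_eq_succ hxy).2, (arrow_of_val_eq_succ hxy).2] at this
    exact this.symm
  · right
    intro k h0 hl
    obtain ⟨x, y, hxy, rfl⟩ := hgaps k h0 hl
    have hxy' : ((x.rev : Fin n) : ℕ) = y.rev + 1 := by
      rw [Fin.val_rev, Fin.val_rev]; omega
    have := h y.rev x.rev
    rw [hrev, hrev, Fin.rev_rev, Fin.rev_rev, (arrow_of_val_eq_succ hxy').1,
      (arrow_of_val_eq_succ hxy).2] at this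
    have hk : y.castSucc.rev = x.rev.castSucc := by
      apply Fin.ext
      simp only [Fin.val_rev, Fin.val_castSucc]
      omega
    rw [hk]
    exact this.symm

/-! ### Linear maps between the facet normals -/

/-- A linear isomorphism that preserves facet normals up to positive factors permutes the
coordinate axes, because these carry the pairs of opposite normals. -/
theorem exists_axis_image {u v : Fin (n + 1) → Prop} {M : (Fin n → ℝ) ≃ₗ[ℝ] (Fin n → ℝ)}
    (hM : ∀ S, IsFacetSet u S → ∃ T, IsFacetSet v T ∧ ∃ c : ℝ, 0 < c ∧
      M (jumpVector S) = c • jumpVector T) (g : Fin n) :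
    ∃ (h : Fin n) (c : ℝ), c ≠ 0 ∧ M (Pi.single g 1) = c • Pi.single h 1 := by
  obtain ⟨T, hT, c, hc, hTc⟩ := hM _ (isFacetSet_Ioi u g)
  obtain ⟨T', hT', c', hc', hTc'⟩ := hM _ (isFacetSet_Iic u g)
  rw [jumpVector_Ioi] at hTc
  rw [jumpVector_Iic, map_neg, hTc] at hTc'
  have hopp : jumpVector T' = jumpVector Tᶜ := by
    refine eq_of_smul_eq_smul (jumpVector_apply_cases T') (jumpVector_apply_cases Tᶜ) hc' hc ?_
    rw [jumpVector_compl, smul_neg, hTc']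
  rw [jumpVector_injective hT'.1 hT'.2.1 hopp] at hT'
  obtain ⟨h, rfl | rfl⟩ := hT.eq_of_compl hT'
  · refine ⟨h, -c, neg_ne_zero.2 hc.ne', ?_⟩
    rw [hTc, jumpVector_Iic, smul_neg, neg_smul]
  · exact ⟨h, c, hc.ne', by rw [hTc, jumpVector_Ioi]⟩

theorem single_sub_single_cases (g h i : Fin n) :
    (Pi.single g 1 - Pi.single h 1 : Fin n → ℝ) i = 0 ∨
      (Pi.single g 1 - Pi.single h 1 : Fin n → ℝ) i = 1 ∨
      (Pi.single g 1 - Pi.single h 1 : Fin n → ℝ) i = -1 := by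
  simp only [Pi.sub_apply, Pi.single_apply]
  split_ifs <;> norm_num

/-- The entries of a facet normal have sum `0`, `1` or `-1`; so two nonzero entries, if there are
no others, are opposite. -/
theorem eq_of_sub_eq_smul_jumpVector {T : Finset (Fin (n + 1))} {g h : Fin n} (hgh : g ≠ h)
    {a b t : ℝ} (ha : a ≠ 0) (hb : b ≠ 0) (ht : 0 < t)
    (hT : a • (Pi.single g 1 : Fin n → ℝ) - b • (Pi.single h 1 : Fin n → ℝ)
      = t • jumpVector T) : a = b := by
  have hg := congrFun hT g
  have hh := congrFun hT h
  have hsum : a - b = t * ∑ i, jumpVector T i := by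
    have := congrArg (fun w : Fin n → ℝ => ∑ i, w i) hT
    simpa [Finset.mul_sum, Pi.single_apply] using this
  rw [sum_jumpVector] at hsum
  simp only [Pi.sub_apply, Pi.smul_apply, smul_eq_mul, Pi.single_eq_same, Pi.single_eq_of_ne hgh,
    Pi.single_eq_of_ne hgh.symm, mul_one, mul_zero, sub_zero, zero_sub] at hg hh
  rcases jumpVector_apply_cases T g with h1 | h1 | h1 <;>
  rcases jumpVector_apply_cases T h with h2 | h2 | h2 <;>
  simp only [h1, mul_zero, mul_one] at hg <;>
  simp only [h2, mul_zero, mul_one, neg_eq_zero] at hh <;>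
  first
  | exact absurd hg ha
  | exact absurd hh hb
  | linarith
  | (exfalso; split_ifs at hsum <;> linarith)

/-- The image of an arrow under a linear isomorphism that preserves facet normals up to positive
factors and acts on two axes by `a` and `b`. -/
theorem arrow_image {u v : Fin (n + 1) → Prop} {M : (Fin n → ℝ) ≃ₗ[ℝ] (Fin n → ℝ)}
    (hM : ∀ S, IsFacetSet u S → ∃ T, IsFacetSet v T ∧ ∃ c : ℝ, 0 < c ∧
      M (jumpVector S) = c • jumpVector T) {g h g' h' : Fin n} (hgh' : g' ≠ h') {a b : ℝ}
    (ha : a ≠ 0) (hb : b ≠ 0) (hg : M (Pi.single g 1) = a • Pi.single g' 1)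
    (hh : M (Pi.single h 1) = b • Pi.single h' 1) (hu : Arrow u g h) :
    a = b ∧ (0 < a → Arrow v g' h') := by
  obtain ⟨S, hS, hSJ⟩ := (exists_isFacetSet_jumpVector_iff u hu.ne).2 hu
  obtain ⟨T, hT, t, ht, hTt⟩ := hM S hS
  rw [hSJ, map_sub, hg, hh] at hTt
  obtain rfl := eq_of_sub_eq_smul_jumpVector hgh' ha hb ht hTt
  refine ⟨rfl, fun hpos => (exists_isFacetSet_jumpVector_iff v hgh').1 ⟨T, hT, ?_⟩⟩
  refine eq_of_smul_eq_smul (jumpVector_apply_cases T) (single_sub_single_cases g' h') ht hpos ?_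
  rw [← hTt, smul_sub]

theorem signs_eq_of_linearEquiv {u v : Fin (n + 1) → Prop} {M : (Fin n → ℝ) ≃ₗ[ℝ] (Fin n → ℝ)}
    (hM : ∀ S, IsFacetSet u S → ∃ T, IsFacetSet v T ∧ ∃ c : ℝ, 0 < c ∧
      M (jumpVector S) = c • jumpVector T)
    (hM' : ∀ T, IsFacetSet v T → ∃ S, IsFacetSet u S ∧ ∃ c : ℝ, 0 < c ∧
      M.symm (jumpVector T) = c • jumpVector S) :
    ((∀ k, k ≠ 0 → k ≠ Fin.last n → (v k ↔ u k)) ∨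
      (∀ k, k ≠ 0 → k ≠ Fin.last n → (v k ↔ ¬ u k.rev))) ∨
    ((∀ k, k ≠ 0 → k ≠ Fin.last n → (v k ↔ ¬ u k)) ∨
      (∀ k, k ≠ 0 → k ≠ Fin.last n → (v k ↔ u k.rev))) := by
  choose π c hc hπ using exists_axis_image hM
  have hinj : Function.Injective π := by
    intro g h hgh
    have h1 : M (c h • Pi.single g 1) = M (c g • Pi.single h 1) := by
      rw [map_smul, map_smul, hπ, hπ, hgh, smul_comm]
    have h2 := congrFun (M.injective h1) g
    by_contra hne
    simp [Pi.single_eq_of_ne hne, hc h] at h2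
  have hadj : ∀ g h : Fin n, (h : ℕ) = g + 1 → c g = c h := by
    intro g h hgh
    by_cases hu : u h.castSucc
    · have harr := (arrow_of_val_eq_succ hgh).2.2 hu
      exact (arrow_image hM (hinj.ne harr.ne) (hc h) (hc g) (hπ h) (hπ g) harr).1.symm
    · have harr := (arrow_of_val_eq_succ hgh).1.2 hu
      exact (arrow_image hM (hinj.ne harr.ne) (hc g) (hc h) (hπ g) (hπ h) harr).1
  have hconst : ∀ (i : ℕ) (hi : i < n) (h0 : 0 < n), c ⟨i, hi⟩ = c ⟨0, h0⟩ := by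
    intro i
    induction i with
    | zero => intros; rfl
    | succ i ih =>
      intro hi h0
      rw [← ih (by omega) h0]
      exact (hadj _ _ rfl).symm
  have hsymm : ∀ g, M.symm (Pi.single (π g) 1) = (c g)⁻¹ • Pi.single g 1 := by
    intro g
    rw [LinearEquiv.symm_apply_eq, map_smul, hπ, inv_smul_smul₀ (hc g)]
  rcases Nat.eq_zero_or_pos n with rfl | hn
  · exact Or.inl (Or.inl fun k hk => absurd (Fin.ext (by omega)) hk)
  rcases (hc ⟨0, hn⟩).lt_or_gt with hneg | hpos
  · right
    -- Composing with `-1` replaces the facet sets by their complements, and `v` by its negation.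
    have hneg' : ∀ g, 0 < -c g := fun g => by
      rw [hconst g g.isLt hn]; linarith
    set N : (Fin n → ℝ) ≃ₗ[ℝ] (Fin n → ℝ) := M.trans (LinearEquiv.neg ℝ)
    have hN : ∀ S, IsFacetSet u S → ∃ T, IsFacetSet (fun k => ¬ v k) T ∧ ∃ c : ℝ, 0 < c ∧
        N (jumpVector S) = c • jumpVector T := by
      intro S hS
      obtain ⟨T, hT, t, ht, hTt⟩ := hM S hS
      refine ⟨Tᶜ, hT.compl fun _ _ _ => Iff.rfl, t, ht, ?_⟩
      rw [jumpVector_compl, smul_neg, ← hTt]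
      rfl
    have hN' : ∀ T, IsFacetSet (fun k => ¬ v k) T → ∃ S, IsFacetSet u S ∧ ∃ c : ℝ, 0 < c ∧
        N.symm (jumpVector T) = c • jumpVector S := by
      intro T hT
      obtain ⟨S, hS, t, ht, hSt⟩ := hM' Tᶜ (hT.compl fun _ _ _ => not_not.symm)
      refine ⟨S, hS, t, ht, ?_⟩
      rw [← hSt, jumpVector_compl]
      rfl
    have hNg : ∀ g, N (Pi.single g 1) = (-c g) • Pi.single (π g) 1 := fun g => by
      rw [neg_smul, ← hπ]; rfl
    have hNg' : ∀ g, N.symm (Pi.single (π g) 1) = (-c g)⁻¹ • Pi.single g 1 := fun g => by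
      rw [LinearEquiv.symm_apply_eq, map_smul, hNg, inv_smul_smul₀ (hneg' g).ne']
    have key := signs_eq_of_arrow_iff (u := u) (v := fun k => ¬ v k) hinj fun g h => ?_
    · refine key.imp (fun H k h0 hl => ?_) (fun H k h0 hl => not_iff_not.1 (H k h0 hl))
      rw [← H k h0 hl, not_not]
    · constructor
      · intro harr
        exact (arrow_image hN (hinj.ne harr.ne) (hneg' g).ne' (hneg' h).ne' (hNg g) (hNg h)
          harr).2 (hneg' g)
      · intro harr
        have hgh : g ≠ h := fun h => harr.ne (congrArg π h)
        exact (arrow_image hN' hgh (inv_ne_zero (hneg' g).ne') (inv_ne_zero (hneg' h).ne')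
          (hNg' g) (hNg' h) harr).2 (inv_pos.2 (hneg' g))
  · left
    have hpos' : ∀ g, 0 < c g := fun g => by rwa [hconst g g.isLt hn]
    refine signs_eq_of_arrow_iff hinj fun g h => ⟨fun harr => ?_, fun harr => ?_⟩
    · exact (arrow_image hM (hinj.ne harr.ne) (hc g) (hc h) (hπ g) (hπ h) harr).2 (hpos' g)
    · have hgh : g ≠ h := fun h => harr.ne (congrArg π h)
      exact (arrow_image hM' hgh (inv_ne_zero (hc g)) (inv_ne_zero (hc h)) (hsymm g) (hsymm h)
        harr).2 (inv_pos.2 (hpos' g))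

end Recovery

/-! ### The diagonals of the polygon -/

namespace SignSeq

variable {n : ℕ}

theorem extended_cases (σ : SignSeq n) (i : Fin (n + 3)) :
    σ.extended i = 1 ∨ σ.extended i = -1 := Int.units_eq_one_or _

/-- A vertex between `a` and `c` lies above the line through them when its sign is `+`, and below
when it is `-`: the function `x ↦ (x + 1) (n + 3 - x)` is strictly concave. -/
theorem vertexHeight_lt_and_gt (σ : SignSeq n) {a b c : Fin (n + 3)} (hab : a < b) (hbc : b < c) :
    (σ.extended b = 1 → ((c : ℕ) - (b : ℕ) : ℤ) * vertexHeight σ a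
        + ((b : ℕ) - (a : ℕ)) * vertexHeight σ c < ((c : ℕ) - (a : ℕ)) * vertexHeight σ b) ∧
    (σ.extended b = -1 → ((c : ℕ) - (a : ℕ)) * vertexHeight σ b <
      ((c : ℕ) - (b : ℕ) : ℤ) * vertexHeight σ a + ((b : ℕ) - (a : ℕ)) * vertexHeight σ c) := by
  set H : Fin (n + 3) → ℤ := fun x => (((x : ℕ) + 1) * (n + 3 - (x : ℕ))) with hH
  have hnonneg : ∀ x, 0 ≤ H x := fun x => by
    have : ((x : ℕ) : ℤ) < n + 3 := by exact_mod_cast x.isLt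
    exact mul_nonneg (by positivity) (by linarith)
  have habs : ∀ x, vertexHeight σ x ≤ H x ∧ -H x ≤ vertexHeight σ x := by
    intro x
    have h0 := hnonneg x
    have hv : vertexHeight σ x = (σ.extended x : ℤ) * H x := rfl
    rcases σ.extended_cases x with h | h <;> rw [hv, h] <;> push_cast <;> constructor <;> linarith
  have h1 : (0 : ℤ) < (b : ℕ) - (a : ℕ) := by
    have := Fin.lt_def.1 hab; omega
  have h2 : (0 : ℤ) < (c : ℕ) - (b : ℕ) := by
    have := Fin.lt_def.1 hbc; omega
  have hconc : ((c : ℕ) - (b : ℕ) : ℤ) * H a + ((b : ℕ) - (a : ℕ)) * H c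
      < ((c : ℕ) - (a : ℕ)) * H b := by
    have h3 : (0 : ℤ) < ((b : ℕ) - (a : ℕ)) * ((c : ℕ) - (b : ℕ)) * ((c : ℕ) - (a : ℕ)) :=
      mul_pos (mul_pos h1 h2) (by linarith)
    have h4 : ((c : ℕ) - (a : ℕ)) * H b
        - (((c : ℕ) - (b : ℕ) : ℤ) * H a + ((b : ℕ) - (a : ℕ)) * H c)
        = ((b : ℕ) - (a : ℕ)) * ((c : ℕ) - (b : ℕ)) * ((c : ℕ) - (a : ℕ)) := by
      simp only [hH]; ring
    linarith
  have hb : vertexHeight σ b = (σ.extended b : ℤ) * H b := rfl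
  have e1 := mul_le_mul_of_nonneg_left (habs a).1 h2.le
  have e2 := mul_le_mul_of_nonneg_left (habs c).1 h1.le
  have e3 := mul_le_mul_of_nonneg_left (habs a).2 h2.le
  have e4 := mul_le_mul_of_nonneg_left (habs c).2 h1.le
  constructor <;> intro h <;> rw [hb, h] <;> push_cast <;> linarith

theorem heightOver_between (σ : SignSeq n) {i j k : Fin (n + 3)} (hik : i < k) (hkj : k < j) :
    (heightOver σ i j k < 0 ↔ σ.extended k ≠ 1) ∧ (0 < heightOver σ i j k ↔ σ.extended k = 1) := by
  obtain ⟨h1, h2⟩ := σ.vertexHeight_lt_and_gt hik hkj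
  have hne : (1 : ℤˣ) ≠ -1 := by decide
  rcases σ.extended_cases k with h | h
  · have : 0 < heightOver σ i j k := by have := h1 h; unfold heightOver; linarith
    exact ⟨by simp [h, this.le], by simp [h, this]⟩
  · have : heightOver σ i j k < 0 := by have := h2 h; unfold heightOver; linarith
    exact ⟨by simp [h, this, hne.symm], by simp [h, this.le, hne.symm]⟩

theorem heightOver_left (σ : SignSeq n) {i j k : Fin (n + 3)} (hki : k < i) (hij : i < j) :
    (heightOver σ i j k < 0 ↔ σ.extended i = 1) ∧ (0 < heightOver σ i j k ↔ σ.extended i ≠ 1) := by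
  obtain ⟨h1, h2⟩ := σ.vertexHeight_lt_and_gt hki hij
  have hne : (1 : ℤˣ) ≠ -1 := by decide
  rcases σ.extended_cases i with h | h
  · have : heightOver σ i j k < 0 := by have := h1 h; unfold heightOver; linarith
    exact ⟨by simp [h, this], by simp [h, this.le]⟩
  · have : 0 < heightOver σ i j k := by have := h2 h; unfold heightOver; linarith
    exact ⟨by simp [h, this.le, hne.symm], by simp [h, this, hne.symm]⟩

theorem heightOver_right (σ : SignSeq n) {i j k : Fin (n + 3)} (hij : i < j) (hjk : j < k) :
    (heightOver σ i j k < 0 ↔ σ.extended j = 1) ∧ (0 < heightOver σ i j k ↔ σ.extended j ≠ 1) := by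
  obtain ⟨h1, h2⟩ := σ.vertexHeight_lt_and_gt hij hjk
  have hne : (1 : ℤˣ) ≠ -1 := by decide
  rcases σ.extended_cases j with h | h
  · have : heightOver σ i j k < 0 := by have := h1 h; unfold heightOver; linarith
    exact ⟨by simp [h, this], by simp [h, this.le]⟩
  · have : 0 < heightOver σ i j k := by have := h2 h; unfold heightOver; linarith
    exact ⟨by simp [h, this.le, hne.symm], by simp [h, this, hne.symm]⟩

theorem heightOver_self_left (σ : SignSeq n) (i j : Fin (n + 3)) : heightOver σ i j i = 0 := by
  simp [heightOver]

theorem heightOver_self_right (σ : SignSeq n) (i j : Fin (n + 3)) : heightOver σ i j j = 0 := by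
  simp [heightOver]

/-- The element of `{0, …, n + 2}` that indexes the coordinate `k`. -/
abbrev vertexOf (k : Fin (n + 1)) : Fin (n + 3) := k.succ.castSucc

/-- The coordinates belonging to vertices with sign `+`. -/
def IsUp (σ : SignSeq n) (k : Fin (n + 1)) : Prop := σ.extended (vertexOf k) = 1

/-- The set `S_{ij}(σ)` as a set of coordinates. -/
def coordSet (σ : SignSeq n) (i j : Fin (n + 3)) : Finset (Fin (n + 1)) :=
  {k | vertexOf k ∈ normalSet σ i j}

theorem eq_zero_or_eq_last_or_eq_vertexOf (m : Fin (n + 3)) :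
    m = 0 ∨ m = Fin.last (n + 2) ∨ ∃ k : Fin (n + 1), m = vertexOf k := by
  rcases m.eq_zero_or_eq_succ with h | ⟨m, rfl⟩
  · exact Or.inl h
  · rcases m.eq_castSucc_or_eq_last with ⟨k, rfl⟩ | rfl
    · exact Or.inr (Or.inr ⟨k, rfl⟩)
    · exact Or.inr (Or.inl rfl)

theorem vertexOf_ne_zero (k : Fin (n + 1)) : vertexOf k ≠ 0 := by
  intro h
  have := congrArg Fin.val h
  simp at this

theorem vertexOf_ne_last (k : Fin (n + 1)) : vertexOf k ≠ Fin.last (n + 2) := by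
  intro h
  have := congrArg Fin.val h
  simp only [Fin.val_castSucc, Fin.val_succ, Fin.val_last] at this
  omega

/-- A vertex other than the first and last one belongs to `S_{ij}(σ)` if it is strictly below `ij`,
or if it is an end of `ij` that replaces the first or last vertex. -/
theorem mem_coordSet (σ : SignSeq n) (i j : Fin (n + 3)) (k : Fin (n + 1)) :
    k ∈ σ.coordSet i j ↔ heightOver σ i j (vertexOf k) < 0 ∨
      (vertexOf k = i ∧ heightOver σ i j 0 < 0) ∨
      (vertexOf k = j ∧ heightOver σ i j (Fin.last (n + 2)) < 0) := by
  have h0 := vertexOf_ne_zero k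
  have hl := vertexOf_ne_last k
  have h0l : Fin.last (n + 2) ≠ 0 := Fin.last_pos.ne'
  simp only [coordSet, normalSet, verticesBelow, Finset.mem_filter, Finset.mem_univ, true_and,
    Finset.mem_image]
  constructor
  · rintro ⟨m, hm, hmk⟩
    split_ifs at hmk with h h'
    · exact Or.inr (Or.inl ⟨hmk.symm, h ▸ hm⟩)
    · exact Or.inr (Or.inr ⟨hmk.symm, h' ▸ hm⟩)
    · exact Or.inl (hmk ▸ hm)
  · rintro (h | ⟨h, h'⟩ | ⟨h, h'⟩)
    · exact ⟨_, h, by rw [if_neg h0, if_neg hl]⟩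
    · exact ⟨0, h', by rw [if_pos rfl, h]⟩
    · exact ⟨Fin.last (n + 2), h', by rw [if_neg h0l, if_pos rfl, h]⟩

theorem mem_coordSet_of_le (σ : SignSeq n) {i j : Fin (n + 3)} (hij : i < j) {k : Fin (n + 1)}
    (hk : vertexOf k ≤ i) : k ∈ σ.coordSet i j ↔ σ.extended i = 1 := by
  have hkj : vertexOf k ≠ j := (hk.trans_lt hij).ne
  rw [mem_coordSet]
  rcases hk.eq_or_lt with h | h
  · have h0 : 0 < i := h ▸ Fin.pos_of_ne_zero (vertexOf_ne_zero k)
    rw [h, heightOver_self_left, (σ.heightOver_left h0 hij).1]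
    simp [hij.ne]
  · rw [(σ.heightOver_left h hij).1]
    simp only [h.ne, hkj, false_and, or_false]

theorem mem_coordSet_of_between (σ : SignSeq n) {i j : Fin (n + 3)} {k : Fin (n + 1)}
    (hik : i < vertexOf k) (hkj : vertexOf k < j) : k ∈ σ.coordSet i j ↔ ¬ σ.IsUp k := by
  rw [mem_coordSet, (σ.heightOver_between hik hkj).1]
  simp only [hik.ne', hkj.ne, false_and, or_false]
  rfl

theorem mem_coordSet_of_ge (σ : SignSeq n) {i j : Fin (n + 3)} (hij : i < j) {k : Fin (n + 1)}
    (hk : j ≤ vertexOf k) : k ∈ σ.coordSet i j ↔ σ.extended j = 1 := by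
  have hki : vertexOf k ≠ i := (hij.trans_le hk).ne'
  rw [mem_coordSet]
  rcases hk.eq_or_lt with h | h
  · have h0 : j < Fin.last (n + 2) := h ▸ Fin.lt_last_iff_ne_last.2 (vertexOf_ne_last k)
    rw [← h, heightOver_self_right, (σ.heightOver_right hij h0).1]
    simp [hij.ne']
  · rw [(σ.heightOver_right hij h).1]
    simp only [h.ne', hki, false_and, or_false]

/-- A segment `ij` is a diagonal exactly when `S_{ij}(σ)` is neither empty nor everything. -/
theorem isDiagonal_iff (σ : SignSeq n) {i j : Fin (n + 3)} (hij : i < j) :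
    IsDiagonal σ i j ↔ (σ.coordSet i j).Nonempty ∧ σ.coordSet i j ≠ Finset.univ := by
  have hbelow : (∃ k, heightOver σ i j k < 0) ↔ (σ.coordSet i j).Nonempty := by
    constructor
    · rintro ⟨m, hm⟩
      rcases eq_zero_or_eq_last_or_eq_vertexOf m with rfl | rfl | ⟨k, rfl⟩
      · rcases eq_zero_or_eq_last_or_eq_vertexOf i with rfl | rfl | ⟨k, rfl⟩
        · exact absurd hm (heightOver_self_left σ 0 j).not_lt
        · exact absurd hij (Fin.le_last j).not_gt
        · exact ⟨k, (σ.mem_coordSet _ _ k).2 (Or.inr (Or.inl ⟨rfl, hm⟩))⟩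
      · rcases eq_zero_or_eq_last_or_eq_vertexOf j with rfl | rfl | ⟨k, rfl⟩
        · exact absurd hij (Fin.zero_le i).not_gt
        · exact absurd hm (heightOver_self_right σ i _).not_lt
        · exact ⟨k, (σ.mem_coordSet _ _ k).2 (Or.inr (Or.inr ⟨rfl, hm⟩))⟩
      · exact ⟨k, (σ.mem_coordSet _ _ k).2 (Or.inl hm)⟩
    · rintro ⟨k, hk⟩
      rcases (σ.mem_coordSet i j k).1 hk with h | ⟨-, h⟩ | ⟨-, h⟩
      exacts [⟨_, h⟩, ⟨_, h⟩, ⟨_, h⟩]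
  have habove : (∃ k, 0 < heightOver σ i j k) ↔ ∃ k, k ∉ σ.coordSet i j := by
    constructor
    · rintro ⟨m, hm⟩
      have hmi : m ≠ i := fun h => by simp [h, heightOver_self_left] at hm
      have hmj : m ≠ j := fun h => by simp [h, heightOver_self_right] at hm
      rcases eq_zero_or_eq_last_or_eq_vertexOf m with rfl | rfl | ⟨k, rfl⟩
      · rcases eq_zero_or_eq_last_or_eq_vertexOf i with rfl | rfl | ⟨k, rfl⟩
        · exact absurd rfl hmi
        · exact absurd hij (Fin.le_last j).not_gt
        · refine ⟨k, fun hk => ?_⟩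
          exact (σ.heightOver_left (Fin.pos_of_ne_zero (vertexOf_ne_zero k)) hij).2.1 hm
            ((σ.mem_coordSet_of_le hij le_rfl).1 hk)
      · rcases eq_zero_or_eq_last_or_eq_vertexOf j with rfl | rfl | ⟨k, rfl⟩
        · exact absurd hij (Fin.zero_le i).not_gt
        · exact absurd rfl hmj
        · refine ⟨k, fun hk => ?_⟩
          exact (σ.heightOver_right hij
            (Fin.lt_last_iff_ne_last.2 (vertexOf_ne_last k))).2.1 hm
            ((σ.mem_coordSet_of_ge hij le_rfl).1 hk)
      · refine ⟨k, fun hk => ?_⟩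
        rcases (σ.mem_coordSet i j k).1 hk with h | ⟨h, -⟩ | ⟨h, -⟩
        exacts [h.not_gt hm, hmi h, hmj h]
    · rintro ⟨k, hk⟩
      rcases lt_trichotomy (vertexOf k) i with h | h | h
      · rw [σ.mem_coordSet_of_le hij h.le] at hk
        exact ⟨_, (σ.heightOver_left h hij).2.2 hk⟩
      · rw [σ.mem_coordSet_of_le hij h.le] at hk
        exact ⟨0, (σ.heightOver_left (h ▸ Fin.pos_of_ne_zero (vertexOf_ne_zero k)) hij).2.2 hk⟩
      · rcases lt_trichotomy (vertexOf k) j with h' | h' | h'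
        · rw [σ.mem_coordSet_of_between h h', not_not] at hk
          exact ⟨_, (σ.heightOver_between h h').2.2 hk⟩
        · rw [σ.mem_coordSet_of_ge hij h'.ge] at hk
          exact ⟨Fin.last (n + 2), (σ.heightOver_right hij
            (h' ▸ Fin.lt_last_iff_ne_last.2 (vertexOf_ne_last k))).2.2 hk⟩
        · rw [σ.mem_coordSet_of_ge hij h'.le] at hk
          exact ⟨_, (σ.heightOver_right hij h').2.2 hk⟩
  rw [IsDiagonal, hbelow, habove, ne_eq, Finset.eq_univ_iff_forall, not_forall]
  exact and_iff_right hij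

theorem vertexOf_le_vertexOf {k l : Fin (n + 1)} : vertexOf k ≤ vertexOf l ↔ k ≤ l := by
  simp

theorem vertexOf_lt_vertexOf {k l : Fin (n + 1)} : vertexOf k < vertexOf l ↔ k < l := by
  simp

theorem zero_lt_vertexOf (k : Fin (n + 1)) : 0 < vertexOf k :=
  Fin.pos_of_ne_zero (vertexOf_ne_zero k)

theorem vertexOf_lt_last (k : Fin (n + 1)) : vertexOf k < Fin.last (n + 2) :=
  Fin.lt_last_iff_ne_last.2 (vertexOf_ne_last k)

theorem not_isUp_zero (σ : SignSeq n) : ¬ σ.IsUp 0 := by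
  simp [IsUp, extended]

theorem not_isUp_last (σ : SignSeq n) : ¬ σ.IsUp (Fin.last n) := by
  simp [IsUp, extended]

/-- The sets belonging to the diagonals of the polygon are the facet sets of the sign pattern. An
end `0` of a diagonal corresponds to a facet set that contains the first element, and the end `1` to
one that does not; similarly for `n + 2` and `n + 1`. -/
theorem exists_isDiagonal_iff (σ : SignSeq n) (S : Finset (Fin (n + 1))) :
    (∃ i j, IsDiagonal σ i j ∧ σ.coordSet i j = S) ↔ IsFacetSet σ.IsUp S := by
  have h0 := σ.not_isUp_zero
  have hl := σ.not_isUp_last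
  constructor
  · rintro ⟨i, j, hd, rfl⟩
    have hij := hd.1
    obtain ⟨hne, huniv⟩ := (σ.isDiagonal_iff hij).1 hd
    refine ⟨hne, huniv, ?_⟩
    have hconst : ∀ b : Prop, ¬ ∀ k, k ∈ σ.coordSet i j ↔ b := by
      intro b hb
      obtain ⟨k, hk⟩ := hne
      exact huniv (Finset.eq_univ_iff_forall.2 fun l => (hb l).2 ((hb k).1 hk))
    obtain ⟨p, hp, hp'⟩ : ∃ p, (∀ k, p < k → i < vertexOf k) ∧ (p ≠ 0 → i = vertexOf p) := by
      rcases eq_zero_or_eq_last_or_eq_vertexOf i with rfl | rfl | ⟨p, rfl⟩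
      · exact ⟨0, fun k _ => zero_lt_vertexOf k, fun h => absurd rfl h⟩
      · exact absurd hij (Fin.le_last j).not_gt
      · exact ⟨p, fun k hk => vertexOf_lt_vertexOf.2 hk, fun _ => rfl⟩
    obtain ⟨q, hq, hq'⟩ : ∃ q, (∀ k, k < q → vertexOf k < j) ∧
        (q ≠ Fin.last n → j = vertexOf q) := by
      rcases eq_zero_or_eq_last_or_eq_vertexOf j with rfl | rfl | ⟨q, rfl⟩
      · exact absurd hij (Fin.zero_le i).not_gt
      · exact ⟨Fin.last n, fun k _ => vertexOf_lt_last k, fun h => absurd rfl h⟩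
      · exact ⟨q, fun k hk => vertexOf_lt_vertexOf.2 hk, fun _ => rfl⟩
    have hpq : p < q := by
      by_contra! hqp
      by_cases hp0 : p = 0
      · have hq0 : q = 0 := Fin.le_zero_iff.1 (hp0 ▸ hqp)
        by_cases hqn : q = Fin.last n
        · refine hconst (0 ∈ σ.coordSet i j) fun k => ?_
          have hk : k = 0 := Fin.le_zero_iff.1 (hq0 ▸ hqn ▸ Fin.le_last k)
          rw [hk]
        · refine hconst _ fun k => σ.mem_coordSet_of_ge hij ?_
          rw [hq' hqn, hq0]
          exact vertexOf_le_vertexOf.2 (Fin.zero_le k)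
      · by_cases hqn : q = Fin.last n
        · refine hconst _ fun k => σ.mem_coordSet_of_le hij ?_
          rw [hp' hp0]
          exact vertexOf_le_vertexOf.2 ((Fin.le_last k).trans (hqn ▸ hqp))
        · rw [hp' hp0, hq' hqn] at hij
          exact absurd (vertexOf_lt_vertexOf.1 hij) hqp.not_gt
    refine ⟨p, q, hpq, fun k hk => ?_, fun hp0 => ?_, fun k hk hk' =>
      σ.mem_coordSet_of_between (hp k hk) (hq k hk'), fun k hk => ?_, fun hqn => ?_⟩
    · by_cases hp0 : p = 0
      · rw [hp0] at hk ⊢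
        rw [Fin.le_zero_iff.1 hk]
      · have hi := hp' hp0
        rw [σ.mem_coordSet_of_le hij (hi ▸ vertexOf_le_vertexOf.2 hk),
          σ.mem_coordSet_of_le hij hi.ge]
    · rw [σ.mem_coordSet_of_le hij (hp' hp0).ge, hp' hp0, IsUp]
    · by_cases hqn : q = Fin.last n
      · rw [hqn] at hk ⊢
        rw [Fin.last_le_iff.1 hk]
      · have hj := hq' hqn
        rw [σ.mem_coordSet_of_ge hij (hj ▸ vertexOf_le_vertexOf.2 hk),
          σ.mem_coordSet_of_ge hij hj.le]
    · rw [σ.mem_coordSet_of_ge hij (hq' hqn).le, hq' hqn, IsUp]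
  · rintro ⟨hne, huniv, p, q, hpq, h1, h2, h3, h4, h5⟩
    -- The left end is `p`, or the vertex `0` if `p` is the first element and belongs to `S`.
    obtain ⟨i, hi1, hi2, hi3, hi4⟩ : ∃ i, (∀ k, p < k → i < vertexOf k) ∧ i < vertexOf q ∧
        (∀ k, k ≤ p → (vertexOf k ≤ i → (k ∈ S ↔ σ.extended i = 1))) ∧
        (∀ k, k ≤ p → i < vertexOf k → (k ∈ S ↔ ¬ σ.IsUp k)) := by
      by_cases hp : p = 0 ∧ p ∈ S
      · obtain ⟨rfl, hpS⟩ := hp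
        refine ⟨0, fun k _ => zero_lt_vertexOf k, zero_lt_vertexOf q,
          fun k _ hk => absurd hk (zero_lt_vertexOf k).not_ge, fun k hk _ => ?_⟩
        obtain rfl := Fin.le_zero_iff.1 hk
        exact iff_of_true hpS h0
      · refine ⟨vertexOf p, fun k hk => vertexOf_lt_vertexOf.2 hk, vertexOf_lt_vertexOf.2 hpq,
          fun k hk _ => ?_, fun k hk hk' => absurd hk' (vertexOf_le_vertexOf.2 hk).not_gt⟩
        rw [h1 k hk]
        by_cases hp0 : p = 0
        · subst hp0
          exact iff_of_false (fun h => hp ⟨rfl, h⟩) h0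
        · exact h2 hp0
    obtain ⟨j, hj1, hj2, hj3, hj4⟩ : ∃ j, (∀ k, k < q → vertexOf k < j) ∧ i < j ∧
        (∀ k, q ≤ k → (j ≤ vertexOf k → (k ∈ S ↔ σ.extended j = 1))) ∧
        (∀ k, q ≤ k → vertexOf k < j → (k ∈ S ↔ ¬ σ.IsUp k)) := by
      by_cases hq : q = Fin.last n ∧ q ∈ S
      · obtain ⟨rfl, hqS⟩ := hq
        refine ⟨Fin.last (n + 2), fun k _ => vertexOf_lt_last k, hi2.trans (vertexOf_lt_last _),
          fun k _ hk => absurd hk (vertexOf_lt_last k).not_ge, fun k hk _ => ?_⟩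
        obtain rfl := Fin.last_le_iff.1 hk
        exact iff_of_true hqS hl
      · refine ⟨vertexOf q, fun k hk => vertexOf_lt_vertexOf.2 hk, hi2,
          fun k hk _ => ?_, fun k hk hk' => absurd hk' (vertexOf_le_vertexOf.2 hk).not_gt⟩
        rw [h4 k hk]
        by_cases hq0 : q = Fin.last n
        · subst hq0
          exact iff_of_false (fun h => hq ⟨rfl, h⟩) hl
        · exact h5 hq0
    have hS : σ.coordSet i j = S := by
      ext k
      rcases le_or_gt k p with hkp | hkp
      · rcases le_or_gt (vertexOf k) i with hki | hki
        · rw [σ.mem_coordSet_of_le hj2 hki, hi3 k hkp hki]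
        · rw [σ.mem_coordSet_of_between hki (hj1 k (hkp.trans_lt hpq)), hi4 k hkp hki]
      · rcases lt_or_ge k q with hkq | hkq
        · rw [σ.mem_coordSet_of_between (hi1 k hkp) (hj1 k hkq), h3 k hkp hkq]
        · rcases le_or_gt j (vertexOf k) with hkj | hkj
          · rw [σ.mem_coordSet_of_ge hj2 hkj, hj3 k hkq hkj]
          · rw [σ.mem_coordSet_of_between (hi1 k hkp) hkj, hj4 k hkq hkj]
    exact ⟨i, j, (σ.isDiagonal_iff hj2).2 (by rw [hS]; exact ⟨hne, huniv⟩), hS⟩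

end SignSeq

/-! ### Symmetries of the associahedra -/

section Symmetry

variable {n : ℕ}

theorem SignSeq.normalSet_eq_map (σ : SignSeq n) {i j : Fin (n + 3)} (hij : i < j) :
    normalSet σ i j = (σ.coordSet i j).map
      ⟨SignSeq.vertexOf, fun _ _ h => Fin.succ_injective _ (Fin.castSucc_injective _ h)⟩ := by
  ext m
  simp only [SignSeq.coordSet, Finset.mem_map, Finset.mem_filter, Finset.mem_univ, true_and]
  constructor
  · intro hm
    rcases SignSeq.eq_zero_or_eq_last_or_eq_vertexOf m with h | h | ⟨k, hk⟩
    · exfalso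
      obtain ⟨l, hl, hlm⟩ := Finset.mem_image.1 hm
      simp only [verticesBelow, Finset.mem_filter, Finset.mem_univ, true_and] at hl
      split_ifs at hlm with h1 h2
      · rw [h1, ← h, ← hlm, σ.heightOver_self_left] at hl
        exact lt_irrefl _ hl
      · exact absurd hij ((hlm.trans h) ▸ (Fin.zero_le i).not_gt)
      · exact h1 (hlm.trans h)
    · exfalso
      obtain ⟨l, hl, hlm⟩ := Finset.mem_image.1 hm
      simp only [verticesBelow, Finset.mem_filter, Finset.mem_univ, true_and] at hl
      split_ifs at hlm with h1 h2
      · exact absurd hij ((hlm.trans h) ▸ (Fin.le_last j).not_gt)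
      · rw [h2, ← h, ← hlm, σ.heightOver_self_right] at hl
        exact lt_irrefl _ hl
      · exact h2 (hlm.trans h)
    · exact ⟨k, hk ▸ hm, hk.symm⟩
  · rintro ⟨k, hk, rfl⟩
    exact hk

theorem hohlwegLangeAssociahedron_eq (σ : SignSeq n) :
    hohlwegLangeAssociahedron σ = familyPolytope {S | IsFacetSet σ.IsUp S} := by
  ext x
  refine and_congr_left fun _ => ?_
  have key : ∀ i j, IsDiagonal σ i j → (normalSet σ i j).card = (σ.coordSet i j).card :=
    fun i j hd => by rw [σ.normalSet_eq_map hd.1, Finset.card_map]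
  constructor
  · intro h S hS
    obtain ⟨i, j, hd, rfl⟩ := (σ.exists_isDiagonal_iff S).2 hS
    have := h i j hd
    rwa [key i j hd] at this
  · intro h i j hd
    have := h _ ((σ.exists_isDiagonal_iff _).1 ⟨i, j, hd, rfl⟩)
    rwa [← key i j hd] at this

/-- The reflection `x ↦ (n + 2) - x` exchanges the inequality for a set with the inequality for its
complement. -/
theorem sub_mem_familyPolytope {𝓢 𝓣 : Set (Finset (Fin (n + 1)))} (h : ∀ T ∈ 𝓣, Tᶜ ∈ 𝓢)
    {x : Fin (n + 1) → ℝ} (hx : x ∈ familyPolytope 𝓢) :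
    -x + (fun _ => (n : ℝ) + 2) ∈ familyPolytope 𝓣 := by
  have hsum : ∀ T : Finset (Fin (n + 1)), ∑ k ∈ T, (-x + (fun _ => (n : ℝ) + 2) : Fin (n + 1) → ℝ) k
      = T.card * ((n : ℝ) + 2) - ∑ k ∈ T, x k := fun T => by
    simp only [Pi.add_apply, Pi.neg_apply, Finset.sum_add_distrib, Finset.sum_neg_distrib,
      Finset.sum_const, nsmul_eq_mul]
    ring
  constructor
  · intro T hT
    have h1 := hx.1 _ (h T hT)
    have h2 := Finset.sum_add_sum_compl T x
    rw [hx.2] at h2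
    have h3 : ((Tᶜ.card : ℕ) : ℝ) = n + 1 - T.card := by
      have := T.card_add_card_compl
      rw [Fintype.card_fin] at this
      have h4 : (T.card : ℝ) + (Tᶜ.card : ℕ) = n + 1 := by exact_mod_cast this
      linarith
    rw [h3] at h1
    rw [hsum]
    nlinarith
  · rw [hsum, hx.2, Finset.card_univ, Fintype.card_fin]
    push_cast
    ring

theorem comp_rev_mem_familyPolytope {𝓢 𝓣 : Set (Finset (Fin (n + 1)))}
    (h : ∀ T ∈ 𝓣, T.map Fin.revPerm.toEmbedding ∈ 𝓢) {x : Fin (n + 1) → ℝ}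
    (hx : x ∈ familyPolytope 𝓢) : (fun k => x k.rev) ∈ familyPolytope 𝓣 := by
  constructor
  · intro T hT
    have := hx.1 _ (h T hT)
    rw [Finset.card_map, Finset.sum_map] at this
    exact this
  · rw [← hx.2]
    exact Equiv.sum_comp Fin.revPerm x

theorem SignSeq.isUp_iff (σ : SignSeq n) {k : Fin (n + 1)} (h0 : k ≠ 0) (hl : k ≠ Fin.last n)
    (hk : (k : ℕ) - 1 < n - 1) : σ.IsUp k ↔ σ ⟨(k : ℕ) - 1, hk⟩ = 1 := by
  have h1 : (k : ℕ) ≠ 0 := fun h => h0 (Fin.ext h)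
  have h2 : (k : ℕ) ≠ n := fun h => hl (Fin.ext h)
  have h3 : 2 ≤ (k : ℕ) + 1 ∧ (k : ℕ) + 1 ≤ n := by omega
  simp only [IsUp, extended, Fin.val_castSucc, Fin.val_succ, h3, and_self, dite_true]
  rfl

theorem SignSeq.isUp_reflection_iff (σ : SignSeq n) (k : Fin (n + 1)) (h0 : k ≠ 0)
    (hl : k ≠ Fin.last n) : σ.reflection.IsUp k ↔ ¬ σ.IsUp k := by
  have h1 : (k : ℕ) ≠ 0 := fun h => h0 (Fin.ext h)
  have h2 : (k : ℕ) ≠ n := fun h => hl (Fin.ext h)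
  have hk : (k : ℕ) - 1 < n - 1 := by omega
  rw [isUp_iff _ h0 hl hk, isUp_iff _ h0 hl hk, reflection]
  rcases Int.units_eq_one_or (σ ⟨(k : ℕ) - 1, hk⟩) with h | h <;> rw [h] <;> decide

theorem SignSeq.isUp_reversal_iff (σ : SignSeq n) (k : Fin (n + 1)) :
    σ.reversal.IsUp k ↔ σ.IsUp k.rev := by
  by_cases h0 : k = 0
  · subst h0
    rw [Fin.rev_zero]
    exact iff_of_false (not_isUp_zero _) (not_isUp_last _)
  by_cases hl : k = Fin.last n
  · subst hl
    rw [Fin.rev_last]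
    exact iff_of_false (not_isUp_last _) (not_isUp_zero _)
  have h1 : (k : ℕ) ≠ 0 := fun h => h0 (Fin.ext h)
  have h2 : (k : ℕ) ≠ n := fun h => hl (Fin.ext h)
  have hk : (k : ℕ) - 1 < n - 1 := by omega
  have h0' : k.rev ≠ 0 := fun h => hl (by rw [← Fin.rev_rev k, h, Fin.rev_zero])
  have hl' : k.rev ≠ Fin.last n := fun h => h0 (by rw [← Fin.rev_rev k, h, Fin.rev_last])
  have hk' : (k.rev : ℕ) - 1 < n - 1 := by rw [Fin.val_rev]; omega
  rw [isUp_iff _ h0 hl hk, isUp_iff _ h0' hl' hk', reversal]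
  have : Fin.rev ⟨(k : ℕ) - 1, hk⟩ = (⟨(k.rev : ℕ) - 1, hk'⟩ : Fin (n - 1)) := by
    apply Fin.ext
    simp only [Fin.val_rev]
    omega
  rw [this]

theorem SignSeq.ext_isUp {σ τ : SignSeq n}
    (h : ∀ k, k ≠ 0 → k ≠ Fin.last n → (τ.IsUp k ↔ σ.IsUp k)) : τ = σ := by
  funext i
  have hi : (i : ℕ) + 1 < n + 1 := by omega
  have h0 : (⟨i + 1, hi⟩ : Fin (n + 1)) ≠ 0 := fun h => by simpa using congrArg Fin.val h
  have hl : (⟨i + 1, hi⟩ : Fin (n + 1)) ≠ Fin.last n := fun h => by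
    have := congrArg Fin.val h
    simp only [Fin.val_last] at this
    omega
  have key : τ i = 1 ↔ σ i = 1 := by
    have := h _ h0 hl
    rwa [isUp_iff _ h0 hl (by simp), isUp_iff _ h0 hl (by simp)] at this
  rcases Int.units_eq_one_or (σ i) with h1 | h1
  · rw [h1, key.2 h1]
  · rw [h1]
    refine (Int.units_eq_one_or (τ i)).resolve_left fun h2 => ?_
    rw [key.1 h2] at h1
    exact absurd h1 (by decide)

theorem normallyIsomorphic_reflection (σ : SignSeq n) :
    NormallyIsomorphic (hohlwegLangeAssociahedron σ) (hohlwegLangeAssociahedron σ.reflection) := by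
  set b : Fin (n + 1) → ℝ := fun _ => (n : ℝ) + 2
  have himage : hohlwegLangeAssociahedron σ.reflection
      = (fun x => ContinuousLinearEquiv.neg ℝ x + b) '' hohlwegLangeAssociahedron σ := by
    rw [hohlwegLangeAssociahedron_eq, hohlwegLangeAssociahedron_eq]
    ext y
    constructor
    · intro hy
      refine ⟨-y + b, sub_mem_familyPolytope (fun T hT => ?_) hy, by simp⟩
      exact IsFacetSet.compl σ.isUp_reflection_iff hT
    · rintro ⟨x, hx, rfl⟩
      refine sub_mem_familyPolytope (fun T hT => ?_) hx
      exact IsFacetSet.compl (fun k h0 hl => by rw [σ.isUp_reflection_iff k h0 hl, not_not]) hT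
  rw [himage]
  exact normallyIsomorphic_image _ b _

theorem normallyIsomorphic_reversal (σ : SignSeq n) :
    NormallyIsomorphic (hohlwegLangeAssociahedron σ) (hohlwegLangeAssociahedron σ.reversal) := by
  have himage : hohlwegLangeAssociahedron σ.reversal
      = (fun x => (LinearEquiv.funCongrLeft ℝ ℝ
          (Fin.revPerm : Equiv.Perm (Fin (n + 1)))).toContinuousLinearEquiv x + 0) ''
        hohlwegLangeAssociahedron σ := by
    rw [hohlwegLangeAssociahedron_eq, hohlwegLangeAssociahedron_eq]
    ext y
    constructor
    · intro hy
      refine ⟨fun k => y k.rev, comp_rev_mem_familyPolytope (fun T hT => ?_) hy, ?_⟩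
      · exact IsFacetSet.map_rev σ.isUp_reversal_iff hT
      · ext k
        simp [LinearEquiv.funCongrLeft_apply, LinearMap.funLeft_apply]
    · rintro ⟨x, hx, rfl⟩
      simp only [add_zero]
      refine comp_rev_mem_familyPolytope (fun T hT => ?_) hx
      exact IsFacetSet.map_rev (fun k => by rw [σ.isUp_reversal_iff, Fin.rev_rev]) hT
  rw [himage]
  exact normallyIsomorphic_image _ 0 _

end Symmetry

theorem mainTheorem2 (n : ℕ) (hn : 1 ≤ n) (σ₁ σ₂ : SignSeq n) :
    NormallyIsomorphic (hohlwegLangeAssociahedron σ₁) (hohlwegLangeAssociahedron σ₂) ↔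
      SignSeq.Equivalent σ₁ σ₂ := by
  constructor
  · intro h
    rw [hohlwegLangeAssociahedron_eq, hohlwegLangeAssociahedron_eq] at h
    obtain ⟨M, hM, hM'⟩ := exists_linearEquiv_of_normallyIsomorphic
      (fun S hS => ⟨hS.1, hS.2.1⟩) (fun S hS => ⟨hS.1, hS.2.1⟩) h
    rcases signs_eq_of_linearEquiv hM hM' with (h | h) | h | h
    · rw [SignSeq.ext_isUp h]
      exact Relation.ReflTransGen.refl
    · have : σ₂ = σ₁.reversal.reflection := SignSeq.ext_isUp fun k h0 hl => by
        rw [h k h0 hl, SignSeq.isUp_reflection_iff _ k h0 hl, SignSeq.isUp_reversal_iff]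
      exact (Relation.ReflTransGen.single (b := σ₁.reversal) (Or.inr rfl)).tail (Or.inl this)
    · have : σ₂ = σ₁.reflection := SignSeq.ext_isUp fun k h0 hl => by
        rw [h k h0 hl, SignSeq.isUp_reflection_iff _ k h0 hl]
      exact Relation.ReflTransGen.single (Or.inl this)
    · have : σ₂ = σ₁.reversal := SignSeq.ext_isUp fun k h0 hl => by
        rw [h k h0 hl, SignSeq.isUp_reversal_iff]
      exact Relation.ReflTransGen.single (Or.inr this)
  · intro h
    induction h with
    | refl => exact NormallyIsomorphic.refl _
    | tail _ hstep ih =>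
      rcases hstep with rfl | rfl
      · exact ih.trans (normallyIsomorphic_reflection _)
      · exact ih.trans (normallyIsomorphic_reversal _)
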